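/- Let $m\ge 3$, let $H$ be a complex Hilbert space, and let $E_1,\dots,E_m$ be spectral measures on measurable spaces $\mathscr X_1,\dots,\mathscr X_m$ with values in the orthogonal projections of $H$. The Haagerup tensor product $L^\infty(E_1)\otimes_h\cdots\otimes_h L^\infty(E_m)$ is the class of functions $\Psi$ on $\mathscr X_1\times\cdots\times\mathscr X_m$ of the form $$\Psi(x_1,\dots,x_m)=\sum_{j_1,\dots,j_{m-1}\ge 0}\alpha_{j_1}(x_1)\,\beta^{(2)}_{j_1j_2}(x_2)\cdots\beta^{(m-1)}_{j_{m-2}j_{m-1}}(x_{m-1})\,\gamma_{j_{m-1}}(x_m)\qquad(*)$$ (almost everywhere, that is, almost everywhere for all products of the measures $\langle E_i(\cdot)h_i,h_i\rangle$, $h_i\in H$; the sum is the limit of the sums over $0\le j_i\le N_i$ as $N_1,\dots,N_{m-1}\to\infty$ independently), where the coefficients are measurable functions with $$\|\alpha\|_{L^\infty(\ell^2)}=E_1\text{-}\operatorname{ess\,sup}\Big(\sum_j|\alpha_j|^2\Big)^{1/2}<\infty,\qquad \|\gamma\|_{L^\infty(\ell^2)}=E_m\text{-}\operatorname{ess\,sup}\Big(\sum_j|\gamma_j|^2\Big)^{1/2}<\infty,$$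 and $\|\beta^{(i)}\|_{L^\infty(\mathcal B)}=E_i\text{-}\operatorname{ess\,sup}\|(\beta^{(i)}_{jk})_{j,k}\|_{\mathcal B(\ell^2)}<\infty$ for $2\le i\le m-1$. The norm $\|\Psi\|_h$ is the infimum of $\|\alpha\|_{L^\infty(\ell^2)}\prod_{i}\|\beta^{(i)}\|_{L^\infty(\mathcal B)}\,\|\gamma\|_{L^\infty(\ell^2)}$ over all representations $(*)$. For bounded operators $T_1,\dots,T_{m-1}$ on $H$ the multiple operator integral is $$\int\!\cdots\!\int\Psi\,dE_1T_1\,dE_2T_2\cdots T_{m-1}\,dE_m=\sum_{j_1,\dots,j_{m-1}}A_{j_1}T_1B^{(2)}_{j_1j_2}T_2\cdots B^{(m-1)}_{j_{m-2}j_{m-1}}T_{m-1}\Gamma_{j_{m-1}},$$ where $A_j=\int\alpha_j\,dE_1$, $B^{(i)}_{jk}=\int\beta^{(i)}_{jk}\,dE_i$, $\Gamma_j=\int\gamma_j\,dE_m$, and the series (summed as in $(*)$) converges in the weak operator topology. For $1\le p<\infty$ let $\boldsymbol S_p$ be the Schatten--von Neumann class, with norm $\|T\|_{\boldsymbol S_p}=\big(\sum_{k\ge0}s_k(T)^p\big)^{1/p}$,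 where $s_k(T)$ is the distance from $T$ to the operators of rank at most $k$; $\boldsymbol S_\infty$ is the space of all bounded operators with the operator norm. Theorem. Let $\Psi\in L^\infty(E_1)\otimes_h\cdots\otimes_h L^\infty(E_m)$, let $T_1\in\boldsymbol S_p$ and $T_{m-1}\in\boldsymbol S_q$ with $p,q\in[2,\infty]$, let $T_2,\dots,T_{m-2}$ be bounded operators on $H$, and let $1/r=1/p+1/q$. Then the series defining the multiple operator integral converges in the weak operator topology for every representation $(*)$ of $\Psi$, to an operator that does not depend on the representation, this operator belongs to $\boldsymbol S_r$, and $$\Big\|\int\!\cdots\!\int\Psi\,dE_1T_1\,dE_2T_2\cdots T_{m-1}\,dE_m\Big\|_{\boldsymbol S_r}\le\|\Psi\|_h\,\|T_1\|_{\boldsymbol S_p}\,\|T_2\|\cdots\|T_{m-2}\|\,\|T_{m-1}\|_{\boldsymbol S_q}.$$ -/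

import Mathlib

open Filter MeasureTheory
open scoped ENNReal Topology

noncomputable section

namespace OperatorIntegral

universe u v

/-- A spectral (projection-valued) measure on the measurable space `X` with values in the
orthogonal projections of the Hilbert space `H`: normalized, and countably additive in the strong
operator topology. Values on non-measurable sets are irrelevant. -/
structure SpectralMeasure (X : Type u) [MeasurableSpace X] (H : Type v) [NormedAddCommGroup H]
    [InnerProductSpace ℂ H] [CompleteSpace H] where
  /-- the projection `E(s)` -/
  proj : Set X → H →L[ℂ] H
  isStarProjection : ∀ s, MeasurableSet s → IsStarProjection (proj s)
  proj_univ : proj Set.univ = 1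
  hasSum_iUnion : ∀ s : ℕ → Set X, (∀ i, MeasurableSet (s i)) → Pairwise (Function.onFun Disjoint s) →
    ∀ h : H, HasSum (fun i => proj (s i) h) (proj (⋃ i, s i) h)

namespace SpectralMeasure

variable {X : Type u} [MeasurableSpace X] {H : Type v} [NormedAddCommGroup H]
  [InnerProductSpace ℂ H] [CompleteSpace H]

theorem inner_proj (E : SpectralMeasure X H) {s : Set X} (hs : MeasurableSet s) (h : H) :
    inner ℂ h (E.proj s h) = ((‖E.proj s h‖ ^ 2 : ℝ) : ℂ) := by
  have hp := E.isStarProjection s hs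
  have h1 : E.proj s (E.proj s h) = E.proj s h := by
    have := congrArg (fun A : H →L[ℂ] H => A h) hp.isIdempotentElem.eq
    simpa using this
  have h2 : (ContinuousLinearMap.adjoint (E.proj s)) = E.proj s := hp.isSelfAdjoint
  calc inner ℂ h (E.proj s h) = inner ℂ h (E.proj s (E.proj s h)) := by rw [h1]
    _ = inner ℂ (ContinuousLinearMap.adjoint (E.proj s) h) (E.proj s h) := by
        rw [ContinuousLinearMap.adjoint_inner_left]
    _ = inner ℂ (E.proj s h) (E.proj s h) := by rw [h2]
    _ = _ := by rw [inner_self_eq_norm_sq_to_K]; norm_cast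

theorem proj_empty (E : SpectralMeasure X H) (h : H) : E.proj ∅ h = 0 := by
  have := E.hasSum_iUnion (fun _ => ∅) (fun _ => MeasurableSet.empty)
    (fun _ _ _ => by simp [Function.onFun]) h
  exact (summable_const_iff _).1 this.summable

/-- The finite positive measure `s ↦ ⟨E(s)h, h⟩ = ‖E(s)h‖²`. -/
def scalarMeasure (E : SpectralMeasure X H) (h : H) : Measure X :=
  Measure.ofMeasurable (fun s _ => ENNReal.ofReal (‖E.proj s h‖ ^ 2))
    (by simp [E.proj_empty])
    (by
      intro s hs hd
      have h1 := ((E.hasSum_iUnion s hs hd h).mapL (innerSL ℂ h))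
      have h2 : HasSum (fun i => ((‖E.proj (s i) h‖ ^ 2 : ℝ) : ℂ))
          ((‖E.proj (⋃ i, s i) h‖ ^ 2 : ℝ) : ℂ) := by
        rw [← E.inner_proj (MeasurableSet.iUnion hs)]
        simpa only [innerSL_apply_apply, E.inner_proj (hs _)] using h1
      have h3 : HasSum (fun i => ‖E.proj (s i) h‖ ^ 2) (‖E.proj (⋃ i, s i) h‖ ^ 2) := by
        exact_mod_cast h2
      rw [← h3.tsum_eq, ENNReal.ofReal_tsum_of_nonneg (fun _ => by positivity) h3.summable])

theorem scalarMeasure_apply (E : SpectralMeasure X H) (h : H) {s : Set X} (hs : MeasurableSet s) :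
    E.scalarMeasure h s = ENNReal.ofReal (‖E.proj s h‖ ^ 2) :=
  Measure.ofMeasurable_apply s hs

instance (E : SpectralMeasure X H) (h : H) : IsFiniteMeasure (E.scalarMeasure h) :=
  ⟨by rw [E.scalarMeasure_apply h MeasurableSet.univ]; exact ENNReal.ofReal_lt_top⟩

/-- The filter of properties that hold `E`-almost everywhere. -/
def ae (E : SpectralMeasure X H) : Filter X :=
  ⨆ h : H, MeasureTheory.ae (E.scalarMeasure h)

/-- A measurable set has full `E`-measure iff `E` of its complement is the zero projection. -/
theorem mem_ae_iff (E : SpectralMeasure X H) {s : Set X} (hs : MeasurableSet s) :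
    s ∈ E.ae ↔ E.proj sᶜ = 0 := by
  simp only [ae, Filter.mem_iSup, MeasureTheory.mem_ae_iff, E.scalarMeasure_apply _ hs.compl,
    ENNReal.ofReal_eq_zero]
  constructor
  · intro h
    ext x
    have h1 := h x
    have h2 : ‖E.proj sᶜ x‖ = 0 := by nlinarith [norm_nonneg (E.proj sᶜ x)]
    simpa using h2
  · intro h x
    simp [h]

/-- `E`-ess sup of an extended nonnegative function. -/
def essSup (E : SpectralMeasure X H) (f : X → ℝ≥0∞) : ℝ≥0∞ :=
  Filter.limsup f E.ae

/-- `A = ∫ f dE` in the weak sense: `⟨Ah, h⟩ = ∫ f d⟨E h, h⟩` for every `h`. On a complex Hilbert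
space this determines `A`. -/
def IsIntegral (E : SpectralMeasure X H) (f : X → ℂ) (A : H →L[ℂ] H) : Prop :=
  ∀ h : H, inner ℂ h (A h) = ∫ x, f x ∂(E.scalarMeasure h)

open Classical in
/-- The operator `∫ f dE`. It is only used for measurable `E`-essentially bounded `f`. -/
def integral (E : SpectralMeasure X H) (f : X → ℂ) : H →L[ℂ] H :=
  if hA : ∃ A, E.IsIntegral f A then hA.choose else 0

end SpectralMeasure

/-- The norm of an infinite matrix `(b j k)` as an operator on `ℓ²`; it is `∞` if the matrix does
not induce a bounded operator on `ℓ²` (the operator inducing it is unique if it exists). -/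
def matrixENorm (b : ℕ → ℕ → ℂ) : ℝ≥0∞ :=
  ⨅ (B : lp (fun _ : ℕ => ℂ) 2 →L[ℂ] lp (fun _ : ℕ => ℂ) 2)
    (_ : ∀ j k, B (lp.single 2 k (1 : ℂ)) j = b j k), ‖B‖ₑ

/-- The norm of a scalar sequence in `ℓ²`, equal to `∞` if the sequence is not in `ℓ²`. -/
def seqENorm (a : ℕ → ℂ) : ℝ≥0∞ :=
  (∑' j, ‖a j‖ₑ ^ 2) ^ (1 / 2 : ℝ)

section Haagerup

variable {H : Type v} [NormedAddCommGroup H] [InnerProductSpace ℂ H] [CompleteSpace H]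
  {n : ℕ} {X : Fin (n + 2) → Type u} [∀ i, MeasurableSpace (X i)]

/-- Almost everywhere on `X₀ × ⋯ × X_{n+1}`: almost everywhere for all the products of scalar
measures `⟨E_i h_i, h_i⟩`. -/
def jointAE (E : ∀ i, SpectralMeasure (X i) H) : Filter (∀ i, X i) :=
  ⨆ h : Fin (n + 2) → H, MeasureTheory.ae (Measure.pi fun i => (E i).scalarMeasure (h i))

/-- A representation
`Ψ(x) = ∑ α_{j₀}(x₀) β⁽¹⁾_{j₀j₁}(x₁) ⋯ β⁽ⁿ⁾_{j_{n-1}j_n}(x_n) γ_{j_n}(x_{n+1})`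
with `α, γ` in `L^∞(ℓ²)` and `β⁽ⁱ⁾` in `L^∞(𝓑)`; the sum is the limit of the sums over boxes
whose sides tend to infinity independently, almost everywhere. The number of variables is `n + 2`;
the `i`-th matrix function (`i : Fin n`, from `0`) lives on `X i.succ.castSucc`. -/
structure HaagerupRep (E : ∀ i, SpectralMeasure (X i) H) (Ψ : (∀ i, X i) → ℂ) where
  /-- the row -/
  α : ℕ → X 0 → ℂ
  /-- the matrices -/
  β : ∀ i : Fin n, ℕ → ℕ → X i.succ.castSucc → ℂ
  /-- the column -/
  γ : ℕ → X (Fin.last (n + 1)) → ℂ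
  measurable_α : ∀ j, Measurable (α j)
  measurable_β : ∀ i j k, Measurable (β i j k)
  measurable_γ : ∀ j, Measurable (γ j)
  bounded_α : (E 0).essSup (fun x => seqENorm fun j => α j x) < ∞
  bounded_β : ∀ i, (E i.succ.castSucc).essSup (fun x => matrixENorm fun j k => β i j k x) < ∞
  bounded_γ : (E (Fin.last (n + 1))).essSup (fun x => seqENorm fun j => γ j x) < ∞
  tendsto_sum : ∀ᶠ x in jointAE E,
    Tendsto (fun N : Fin (n + 1) → ℕ => ∑ j ∈ Fintype.piFinset fun i => Finset.range (N i),
      α (j 0) (x 0) * (∏ i : Fin n, β i (j i.castSucc) (j i.succ) (x i.succ.castSucc)) *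
        γ (j (Fin.last n)) (x (Fin.last (n + 1)))) atTop (𝓝 (Ψ x))

namespace HaagerupRep

variable {E : ∀ i, SpectralMeasure (X i) H} {Ψ : (∀ i, X i) → ℂ}

/-- `‖α‖_{L^∞(ℓ²)} ∏ ‖β⁽ⁱ⁾‖_{L^∞(𝓑)} ‖γ‖_{L^∞(ℓ²)}`. -/
def size (R : HaagerupRep E Ψ) : ℝ≥0∞ :=
  (E 0).essSup (fun x => seqENorm fun j => R.α j x) *
    (∏ i : Fin n, (E i.succ.castSucc).essSup fun x => matrixENorm fun j k => R.β i j k x) *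
    (E (Fin.last (n + 1))).essSup (fun x => seqENorm fun j => R.γ j x)

/-- The operator `A_{j₀} T₀ B⁽¹⁾_{j₀j₁} T₁ ⋯ B⁽ⁿ⁾_{j_{n-1}j_n} T_n Γ_{j_n}`, where
`A_j = ∫ α_j dE₀` and so on. -/
def opTerm (R : HaagerupRep E Ψ) (T : Fin (n + 1) → H →L[ℂ] H) (j : Fin (n + 1) → ℕ) :
    H →L[ℂ] H :=
  (E 0).integral (R.α (j 0)) * T 0 *
    (List.ofFn fun i : Fin n =>
      (E i.succ.castSucc).integral (R.β i (j i.castSucc) (j i.succ)) * T i.succ).prod *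
    (E (Fin.last (n + 1))).integral (R.γ (j (Fin.last n)))

/-- The partial sum of the operators `opTerm` over a box. -/
def opPartialSum (R : HaagerupRep E Ψ) (T : Fin (n + 1) → H →L[ℂ] H) (N : Fin (n + 1) → ℕ) :
    H →L[ℂ] H :=
  ∑ j ∈ Fintype.piFinset fun i => Finset.range (N i), R.opTerm T j

end HaagerupRep

/-- `Ψ ∈ L^∞(E₀) ⊗_h ⋯ ⊗_h L^∞(E_{n+1})`. -/
def MemHaagerup (E : ∀ i, SpectralMeasure (X i) H) (Ψ : (∀ i, X i) → ℂ) : Prop :=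
  Nonempty (HaagerupRep E Ψ)

/-- The norm of `Ψ` in the Haagerup tensor product. -/
def haagerupENorm (E : ∀ i, SpectralMeasure (X i) H) (Ψ : (∀ i, X i) → ℂ) : ℝ≥0∞ :=
  ⨅ R : HaagerupRep E Ψ, R.size

/-- `J = ∫⋯∫ Ψ dE₀ T₀ dE₁ T₁ ⋯ T_n dE_{n+1}`: the function `Ψ` has a representation and, for every
representation, the operator series converges to `J` in the weak operator topology. -/
def IsMultipleOperatorIntegral (E : ∀ i, SpectralMeasure (X i) H) (Ψ : (∀ i, X i) → ℂ)
    (T : Fin (n + 1) → H →L[ℂ] H) (J : H →L[ℂ] H) : Prop :=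
  MemHaagerup E Ψ ∧ ∀ R : HaagerupRep E Ψ, ∀ g h : H,
    Tendsto (fun N : Fin (n + 1) → ℕ => inner ℂ g (R.opPartialSum T N h)) atTop
      (𝓝 (inner ℂ g (J h)))

open Classical in
/-- The multiple operator integral `∫⋯∫ Ψ dE₀ T₀ dE₁ T₁ ⋯ T_n dE_{n+1}` (zero if the operator
series does not converge to one and the same operator for all representations of `Ψ`). -/
def multipleOperatorIntegral (E : ∀ i, SpectralMeasure (X i) H) (Ψ : (∀ i, X i) → ℂ)
    (T : Fin (n + 1) → H →L[ℂ] H) : H →L[ℂ] H :=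
  if hJ : ∃ J, IsMultipleOperatorIntegral E Ψ T J then hJ.choose else 0

end Haagerup

section Schatten

variable {H : Type v} [NormedAddCommGroup H] [InnerProductSpace ℂ H]

/-- The singular value `s_k(T)`: the distance from `T` to the operators of rank at most `k`. -/
def singularValue (T : H →L[ℂ] H) (k : ℕ) : ℝ≥0∞ :=
  ⨅ (F : H →L[ℂ] H) (_ : (F : H →ₗ[ℂ] H).rank ≤ k), ‖T - F‖ₑ

/-- The Schatten--von Neumann norm `(∑ s_k(T)^p)^{1/p}`, and the operator norm for `p = ∞`. -/
def schattenENorm (p : ℝ≥0∞) (T : H →L[ℂ] H) : ℝ≥0∞ :=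
  if p = ∞ then ‖T‖ₑ else (∑' k, singularValue T k ^ p.toReal) ^ (1 / p.toReal)

/-- `T ∈ S_p`; for `p = ∞` every bounded operator. -/
def MemSchatten (p : ℝ≥0∞) (T : H →L[ℂ] H) : Prop :=
  schattenENorm p T < ∞

end Schatten

end OperatorIntegral

end

noncomputable section

namespace OperatorIntegral

universe u v

/-! ### Spectral integrals of bounded functions and of bounded matrix functions. -/

namespace SpectralMeasure

variable {X : Type u} [MeasurableSpace X] {H : Type v} [NormedAddCommGroup H]
  [InnerProductSpace ℂ H] [CompleteSpace H]

/-! A representation of `Ψ` becomes a product of bounded operators on `ℓ²(H)`. The row gives `V x =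
(A_j* x)_j` and the column gives `W x = (Γ_j x)_j`, both from `H` to `ℓ²(H)`. Each matrix `β⁽ⁱ⁾`
gives an operator `Bop i` on `ℓ²(H)` whose norm is at most the essential supremum. The multiple
operator integral is then `V* (T₀ ⊗ 1) Bop₁ (T₁ ⊗ 1) ⋯ (T_n ⊗ 1) W` (`chainOp`).

Convergence: a box sum is the same product with coordinate truncations inserted. These are
contractions tending strongly to the identity (`tendsto_inner_boxSum`).

Independence of the representation: matrix coefficients of the chain are multilinear in `T` and
continuous under bounded strong convergence, so rank one operators suffice (`inner_chainOp_congr`).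
For those, each term is a product of coefficients of spectral integrals. After polarization the
limit is a combination of integrals of `Ψ` against products of scalar measures, by dominated
convergence (`exists_tendsto_rankOne`).

Schatten bound: for orthonormal `e`, `f`, the coefficient `⟨f_k, J e_k⟩` is at most a constant times
`‖(T₀* ⊗ 1) V f_k‖ ‖(T_n ⊗ 1) W e_k‖`. If `T_n` has singular values `σ_l` and right singular vectors
`u_l`, then `‖(T_n ⊗ 1) W e_k‖² = ∑_l d_kl σ_l²` with `d_kl = ∑_j |⟨u_l, Γ_j e_k⟩|²`. Spectral
integrals are normal, so the column bound holds for both `Γ_j` and `Γ_j*`. Hence the row sums and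
the column sums of `d` are at most `c²`, where `c` is the column norm, and `d` acts on `ℓ^{q/2}`
with norm at most `c²`. This is where `q ≥ 2` enters (`FiniteSVD.sum_norm_amp_rpow_le`). Hölder's
inequality then bounds `∑ |⟨f_k, J e_k⟩|^r`, which controls the Schatten norm
(`schattenENorm_le_of_lpBound`). -/

theorem scalarMeasure_real_apply (E : SpectralMeasure X H) (h : H) {s : Set X}
    (hs : MeasurableSet s) : (E.scalarMeasure h).real s = ‖E.proj s h‖ ^ 2 := by
  rw [Measure.real, E.scalarMeasure_apply h hs, ENNReal.toReal_ofReal (by positivity)]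

theorem norm_proj_apply_le (E : SpectralMeasure X H) {s : Set X} (hs : MeasurableSet s) (h : H) :
    ‖E.proj s h‖ ≤ ‖h‖ := by
  have h1 := measureReal_mono (μ := E.scalarMeasure h) (Set.subset_univ s)
  rw [E.scalarMeasure_real_apply h hs, E.scalarMeasure_real_apply h MeasurableSet.univ,
    E.proj_univ] at h1
  exact le_of_sq_le_sq h1 (norm_nonneg _)

/-- Orthogonality is not an axiom of `SpectralMeasure`. It follows from additivity of the scalar
measure of `E(t)h`: `‖E(s)E(t)h‖² + ‖E(t)h‖² = ‖E(s ∪ t)E(t)h‖² ≤ ‖E(t)h‖²`. -/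
theorem proj_apply_proj_of_disjoint (E : SpectralMeasure X H) {s t : Set X} (hs : MeasurableSet s)
    (ht : MeasurableSet t) (hst : Disjoint s t) (h : H) : E.proj s (E.proj t h) = 0 := by
  have h1 := measureReal_union (μ := E.scalarMeasure (E.proj t h)) hst ht
  have hidem : E.proj t (E.proj t h) = E.proj t h := by
    have := congrArg (fun A : H →L[ℂ] H => A h) (E.isStarProjection t ht).isIdempotentElem.eq
    simpa using this
  rw [E.scalarMeasure_real_apply _ hs, E.scalarMeasure_real_apply _ ht,
    E.scalarMeasure_real_apply _ (hs.union ht), hidem] at h1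
  have h2 := E.norm_proj_apply_le (hs.union ht) (E.proj t h)
  have h3 : ‖E.proj s (E.proj t h)‖ ^ 2 ≤ 0 := by
    nlinarith [norm_nonneg (E.proj (s ∪ t) (E.proj t h)), norm_nonneg (E.proj t h)]
  have h4 : ‖E.proj s (E.proj t h)‖ = 0 := by
    nlinarith [norm_nonneg (E.proj s (E.proj t h))]
  simpa using h4

theorem inner_proj_left (E : SpectralMeasure X H) {s : Set X} (hs : MeasurableSet s) (g h : H) :
    inner ℂ (E.proj s g) h = inner ℂ g (E.proj s h) := by
  have h2 : (ContinuousLinearMap.adjoint (E.proj s)) = E.proj s :=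
    (E.isStarProjection s hs).isSelfAdjoint
  conv_lhs => rw [← h2]
  rw [ContinuousLinearMap.adjoint_inner_left]

theorem norm_sq_sum_proj (E : SpectralMeasure X H) {V : Type*} (F : SimpleFunc X V) (s : Finset V)
    (y : V → H) :
    ‖∑ v ∈ s, E.proj (F ⁻¹' {v}) (y v)‖ ^ 2 = ∑ v ∈ s, ‖E.proj (F ⁻¹' {v}) (y v)‖ ^ 2 := by
  classical
  induction s using Finset.induction_on with
  | empty => simp
  | insert a s ha ih =>
    rw [Finset.sum_insert ha, Finset.sum_insert ha, ← ih, sq, sq, sq]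
    refine norm_add_sq_eq_norm_sq_add_norm_sq_of_inner_eq_zero (𝕜 := ℂ) _ _ ?_
    rw [inner_sum]
    refine Finset.sum_eq_zero fun v hv => ?_
    rw [E.inner_proj_left (F.measurableSet_fiber a), E.proj_apply_proj_of_disjoint
      (F.measurableSet_fiber a) (F.measurableSet_fiber v), inner_zero_right]
    refine Disjoint.preimage _ ?_
    rw [Set.disjoint_singleton]
    rintro rfl
    exact ha hv

theorem integral_simpleFunc (μ : Measure X) [IsFiniteMeasure μ] {V W : Type*}
    [NormedAddCommGroup W] [NormedSpace ℝ W] [CompleteSpace W] (F : SimpleFunc X V) (φ : V → W) :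
    ∫ x, φ (F x) ∂μ = ∑ v ∈ F.range, μ.real (F ⁻¹' {v}) • φ v := by
  classical
  have h1 : ∀ x, φ (F x) = ∑ v ∈ F.range, (F ⁻¹' {v}).indicator (fun _ => φ v) x := by
    intro x
    rw [Finset.sum_eq_single (F x)]
    · simp
    · intro v _ hv
      simp [Ne.symm hv]
    · intro hx
      simp at hx
  simp_rw [h1]
  rw [integral_finsetSum]
  · refine Finset.sum_congr rfl fun v _ => ?_
    rw [integral_indicator_const _ (F.measurableSet_fiber v)]
  · intro v _
    exact (integrable_const _).indicator (F.measurableSet_fiber v)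

/-- The integral of `φ ∘ F` for a simple function `F`. -/
def simpleIntegral (E : SpectralMeasure X H) {V : Type*} (F : SimpleFunc X V) (φ : V → ℂ) :
    H →L[ℂ] H :=
  ∑ v ∈ F.range, φ v • E.proj (F ⁻¹' {v})

theorem simpleIntegral_apply (E : SpectralMeasure X H) {V : Type*} (F : SimpleFunc X V)
    (φ : V → ℂ) (h : H) :
    E.simpleIntegral F φ h = ∑ v ∈ F.range, E.proj (F ⁻¹' {v}) (φ v • h) := by
  simp [simpleIntegral]

theorem isIntegral_simpleIntegral (E : SpectralMeasure X H) {V : Type*} (F : SimpleFunc X V)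
    (φ : V → ℂ) : E.IsIntegral (fun x => φ (F x)) (E.simpleIntegral F φ) := by
  intro h
  rw [integral_simpleFunc, simpleIntegral_apply, inner_sum]
  refine Finset.sum_congr rfl fun v _ => ?_
  rw [map_smul, inner_smul_right, E.inner_proj (F.measurableSet_fiber v),
    E.scalarMeasure_real_apply _ (F.measurableSet_fiber v), Complex.real_smul, mul_comm]

theorem norm_sq_simpleIntegral_apply (E : SpectralMeasure X H) {V : Type*} (F : SimpleFunc X V)
    (φ : V → ℂ) (h : H) :
    ‖E.simpleIntegral F φ h‖ ^ 2 = ∫ x, ‖φ (F x)‖ ^ 2 ∂(E.scalarMeasure h) := by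
  rw [simpleIntegral_apply, norm_sq_sum_proj, integral_simpleFunc _ F (fun v => ‖φ v‖ ^ 2)]
  refine Finset.sum_congr rfl fun v _ => ?_
  rw [map_smul, norm_smul, E.scalarMeasure_real_apply _ (F.measurableSet_fiber v), smul_eq_mul]
  ring

variable {E : SpectralMeasure X H}

theorem ae_le_ae (h : H) : MeasureTheory.ae (E.scalarMeasure h) ≤ E.ae :=
  le_iSup (fun h : H => MeasureTheory.ae (E.scalarMeasure h)) h

instance : CountableInterFilter E.ae := by
  refine ⟨fun S hS h => ?_⟩
  simp only [ae, Filter.mem_iSup] at h ⊢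
  intro i
  exact (countable_sInter_mem hS).2 fun s hs => h s hs i

/-- Over `ℂ` the quadratic form determines the operator. -/
theorem IsIntegral.unique {f : X → ℂ} {A B : H →L[ℂ] H} (hA : E.IsIntegral f A)
    (hB : E.IsIntegral f B) : A = B := by
  have : (A : H →ₗ[ℂ] H) = B := by
    rw [← ext_inner_map]
    intro x
    have h1 := (hA x).trans (hB x).symm
    have := congrArg (starRingEnd ℂ) h1
    rwa [inner_conj_symm, inner_conj_symm] at this
  exact ContinuousLinearMap.coe_injective this

theorem IsIntegral.adjoint {f : X → ℂ} {A : H →L[ℂ] H} (hA : E.IsIntegral f A) :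
    E.IsIntegral (fun x => starRingEnd ℂ (f x)) (ContinuousLinearMap.adjoint A) := fun h => by
  rw [ContinuousLinearMap.adjoint_inner_right, ← inner_conj_symm, hA h, integral_conj]

/-- Measurable and essentially bounded functions. -/
def EssBounded (E : SpectralMeasure X H) (f : X → ℂ) : Prop :=
  Measurable f ∧ ∃ c : ℝ, ∀ᶠ x in E.ae, ‖f x‖ ≤ c

theorem EssBounded.integrable {f : X → ℂ} (hf : E.EssBounded f) (h : H) :
    Integrable f (E.scalarMeasure h) := by
  obtain ⟨hm, c, hc⟩ := hf
  exact Integrable.of_bound hm.aestronglyMeasurable c (ae_le_ae h hc)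

theorem EssBounded.conj {f : X → ℂ} (hf : E.EssBounded f) :
    E.EssBounded (fun x => starRingEnd ℂ (f x)) := by
  obtain ⟨hm, c, hc⟩ := hf
  exact ⟨Complex.continuous_conj.measurable.comp hm, c, hc.mono fun x hx => by simpa using hx⟩

theorem EssBounded.sub {f g : X → ℂ} (hf : E.EssBounded f) (hg : E.EssBounded g) :
    E.EssBounded (fun x => f x - g x) := by
  obtain ⟨hm, c, hc⟩ := hf
  obtain ⟨hm', c', hc'⟩ := hg
  refine ⟨hm.sub hm', c + c', ?_⟩
  filter_upwards [hc, hc'] with x h1 h2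
  exact (norm_sub_le _ _).trans (add_le_add h1 h2)

theorem IsIntegral.sub {f g : X → ℂ} {A B : H →L[ℂ] H} (hA : E.IsIntegral f A)
    (hB : E.IsIntegral g B) (hf : E.EssBounded f) (hg : E.EssBounded g) :
    E.IsIntegral (fun x => f x - g x) (A - B) := fun h => by
  rw [sub_apply, inner_sub_right, hA h, hB h,
    integral_sub (hf.integrable h) (hg.integrable h)]

/-- For simple functions `‖A h‖² = ∫ |f|²` is Pythagoras. The identity makes the integrals of simple
approximants strongly Cauchy, and it survives in the limit. -/
theorem EssBounded.exists_isIntegral {f : X → ℂ} (hf : E.EssBounded f) :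
    ∃ A, E.IsIntegral f A ∧ ∀ h, ‖A h‖ ^ 2 = ∫ x, ‖f x‖ ^ 2 ∂(E.scalarMeasure h) := by
  obtain ⟨hm, c', hc'⟩ := hf
  obtain ⟨c, hc0, hc⟩ : ∃ c : ℝ, 0 ≤ c ∧ ∀ᶠ x in E.ae, ‖f x‖ ≤ c :=
    ⟨max c' 0, le_max_right _ _, hc'.mono fun x hx => hx.trans (le_max_left _ _)⟩
  have h0 : (0 : ℂ) ∈ Metric.closedBall (0 : ℂ) c := by simpa using hc0
  -- Approximating inside the ball keeps every approximant bounded by `c` everywhere; only the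
  -- convergence is restricted to almost every point.
  set F : ℕ → SimpleFunc X ℂ := SimpleFunc.approxOn f hm (Metric.closedBall 0 c) 0 h0 with hF
  have hFle : ∀ n x, ‖F n x‖ ≤ c := fun n x => by
    simpa using SimpleFunc.approxOn_mem hm h0 n x
  have hFt : ∀ᶠ x in E.ae, Tendsto (fun n => F n x) atTop (𝓝 (f x)) := by
    filter_upwards [hc] with x hx
    exact SimpleFunc.tendsto_approxOn hm h0 (subset_closure (by simpa using hx))
  set A : ℕ → H →L[ℂ] H := fun n => E.simpleIntegral (F n) id with hA
  have hdiff : ∀ m n h, ‖A m h - A n h‖ ^ 2 = ∫ x, ‖F m x - F n x‖ ^ 2 ∂(E.scalarMeasure h) := by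
    intro m n h
    have hb : ∀ n, E.EssBounded (F n) := fun n =>
      ⟨(F n).measurable, c, Eventually.of_forall (hFle n)⟩
    have h1 := (E.isIntegral_simpleIntegral (F m) id).sub (E.isIntegral_simpleIntegral (F n) id)
      (hb m) (hb n)
    -- On the common refinement the difference is a single simple integral, so the norm identity
    -- applies to it.
    have h2 := E.isIntegral_simpleIntegral ((F m).pair (F n)) (fun z => z.1 - z.2)
    have h3 := h1.unique h2
    rw [← sub_apply, h3, E.norm_sq_simpleIntegral_apply]
    rfl
  have hcau : ∀ h, CauchySeq fun n => A n h := by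
    intro h
    rw [cauchySeq_iff_tendsto_dist_atTop_0]
    have h1 : Tendsto (fun n : ℕ × ℕ => ∫ x, ‖F n.1 x - F n.2 x‖ ^ 2 ∂(E.scalarMeasure h)) atTop
        (𝓝 (∫ x, (0 : ℝ) ∂(E.scalarMeasure h))) := by
      refine tendsto_integral_filter_of_dominated_convergence (fun _ => (c + c) ^ 2) ?_ ?_
        (integrable_const _) ?_
      · refine Eventually.of_forall fun n => ?_
        exact (((F n.1).measurable.sub (F n.2).measurable).norm.pow_const 2).aestronglyMeasurable
      · refine Eventually.of_forall fun n => Eventually.of_forall fun x => ?_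
        rw [Real.norm_of_nonneg (by positivity)]
        exact pow_le_pow_left₀ (norm_nonneg _)
          ((norm_sub_le _ _).trans (add_le_add (hFle _ _) (hFle _ _))) 2
      · filter_upwards [ae_le_ae h hFt] with x hx
        have h2 : Tendsto (fun n : ℕ × ℕ => F n.1 x - F n.2 x) atTop (𝓝 (f x - f x)) := by
          rw [← prod_atTop_atTop_eq]
          exact (hx.comp tendsto_fst).sub (hx.comp tendsto_snd)
        simpa using (h2.norm.pow 2)
    simp only [integral_zero] at h1
    have h2 := h1.sqrt
    simp only [Real.sqrt_zero] at h2
    refine h2.congr fun n => ?_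
    rw [← hdiff, Real.sqrt_sq (norm_nonneg _), dist_eq_norm]
  choose B hB using fun h => cauchySeq_tendsto_of_complete (hcau h)
  have hB' : Tendsto (fun n x => A n x) atTop (𝓝 B) := tendsto_pi_nhds.2 hB
  refine ⟨continuousLinearMapOfTendsto A hB', fun h => ?_, fun h => ?_⟩
  · have h1 : Tendsto (fun n => inner ℂ h (A n h)) atTop (𝓝 (inner ℂ h (B h))) :=
      tendsto_const_nhds.inner (hB h)
    have h2 : Tendsto (fun n => ∫ x, F n x ∂(E.scalarMeasure h)) atTop
        (𝓝 (∫ x, f x ∂(E.scalarMeasure h))) := by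
      refine tendsto_integral_of_dominated_convergence (fun _ => c) ?_ (integrable_const _) ?_ ?_
      · exact fun n => (F n).aestronglyMeasurable
      · exact fun n => Eventually.of_forall (hFle n)
      · exact ae_le_ae h hFt
    exact tendsto_nhds_unique h1 (h2.congr fun n =>
      (E.isIntegral_simpleIntegral (F n) id h).symm)
  · have h1 : Tendsto (fun n => ‖A n h‖ ^ 2) atTop (𝓝 (‖B h‖ ^ 2)) := (hB h).norm.pow 2
    have h2 : Tendsto (fun n => ∫ x, ‖F n x‖ ^ 2 ∂(E.scalarMeasure h)) atTop
        (𝓝 (∫ x, ‖f x‖ ^ 2 ∂(E.scalarMeasure h))) := by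
      refine tendsto_integral_of_dominated_convergence (fun _ => c ^ 2) ?_ (integrable_const _) ?_ ?_
      · exact fun n => ((F n).measurable.norm.pow_const 2).aestronglyMeasurable
      · refine fun n => Eventually.of_forall fun x => ?_
        rw [Real.norm_of_nonneg (by positivity)]
        exact pow_le_pow_left₀ (norm_nonneg _) (hFle _ _) 2
      · filter_upwards [ae_le_ae h hFt] with x hx
        exact hx.norm.pow 2
    exact tendsto_nhds_unique h1 (h2.congr fun n =>
      (E.norm_sq_simpleIntegral_apply (F n) id h).symm)

theorem EssBounded.isIntegral {f : X → ℂ} (hf : E.EssBounded f) :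
    E.IsIntegral f (E.integral f) := by
  have h : ∃ A, E.IsIntegral f A := hf.exists_isIntegral.imp fun _ h => h.1
  rw [integral, dif_pos h]
  exact h.choose_spec

theorem IsIntegral.norm_sq_apply {f : X → ℂ} {A : H →L[ℂ] H} (hA : E.IsIntegral f A)
    (hf : E.EssBounded f) (h : H) : ‖A h‖ ^ 2 = ∫ x, ‖f x‖ ^ 2 ∂(E.scalarMeasure h) := by
  obtain ⟨B, hB, hn⟩ := hf.exists_isIntegral
  rw [hA.unique hB, hn]

theorem IsIntegral.norm_sq_adjoint_apply {f : X → ℂ} {A : H →L[ℂ] H} (hA : E.IsIntegral f A)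
    (hf : E.EssBounded f) (h : H) :
    ‖ContinuousLinearMap.adjoint A h‖ ^ 2 = ∫ x, ‖f x‖ ^ 2 ∂(E.scalarMeasure h) := by
  rw [hA.adjoint.norm_sq_apply hf.conj]
  simp

/-- Dominated convergence for spectral integrals, in the strong operator topology. -/
theorem tendsto_apply_of_dominated {f : ℕ → X → ℂ} {g : X → ℂ} {A : ℕ → H →L[ℂ] H}
    {B : H →L[ℂ] H} (hA : ∀ n, E.IsIntegral (f n) (A n)) (hB : E.IsIntegral g B)
    (hf : ∀ n, Measurable (f n)) (hg : Measurable g) {c : ℝ}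
    (hfc : ∀ n, ∀ᶠ x in E.ae, ‖f n x‖ ≤ c) (hgc : ∀ᶠ x in E.ae, ‖g x‖ ≤ c)
    (hlim : ∀ᶠ x in E.ae, Tendsto (fun n => f n x) atTop (𝓝 (g x))) (h : H) :
    Tendsto (fun n => A n h) atTop (𝓝 (B h)) := by
  have hfb : ∀ n, E.EssBounded (f n) := fun n => ⟨hf n, c, hfc n⟩
  have hgb : E.EssBounded g := ⟨hg, c, hgc⟩
  have h1 : Tendsto (fun n => ∫ x, ‖f n x - g x‖ ^ 2 ∂(E.scalarMeasure h)) atTop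
      (𝓝 (∫ x, (0 : ℝ) ∂(E.scalarMeasure h))) := by
    refine tendsto_integral_of_dominated_convergence (fun _ => (c + c) ^ 2) ?_
      (integrable_const _) ?_ ?_
    · exact fun n => (((hf n).sub hg).norm.pow_const 2).aestronglyMeasurable
    · intro n
      filter_upwards [ae_le_ae h (hfc n), ae_le_ae h hgc] with x h2 h3
      rw [Real.norm_of_nonneg (by positivity)]
      exact pow_le_pow_left₀ (norm_nonneg _) ((norm_sub_le _ _).trans (add_le_add h2 h3)) 2
    · filter_upwards [ae_le_ae h hlim] with x hx
      simpa using (hx.sub_const (g x)).norm.pow 2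
  simp only [integral_zero] at h1
  rw [tendsto_iff_norm_sub_tendsto_zero]
  have h2 := h1.sqrt
  simp only [Real.sqrt_zero] at h2
  refine h2.congr fun n => ?_
  rw [← ((hA n).sub hB (hfb n) hgb).norm_sq_apply ((hfb n).sub hgb) h,
    Real.sqrt_sq (norm_nonneg _)]
  rfl

theorem scalarMeasure_real_univ (h : H) :
    (E.scalarMeasure h).real Set.univ = ‖h‖ ^ 2 := by
  rw [E.scalarMeasure_real_apply h MeasurableSet.univ, E.proj_univ]
  rfl

/-- If `∑ |f_j|² ≤ c²` almost everywhere, then `∑ ‖(∫ f_j dE) h‖² ≤ c² ‖h‖²`. -/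
theorem sum_integral_norm_sq_le {f : ℕ → X → ℂ} (hf : ∀ j, E.EssBounded (f j)) {c : ℝ}
    (hc : ∀ᶠ x in E.ae, ∀ s : Finset ℕ, ∑ j ∈ s, ‖f j x‖ ^ 2 ≤ c ^ 2) (h : H) (s : Finset ℕ) :
    ∑ j ∈ s, ∫ x, ‖f j x‖ ^ 2 ∂(E.scalarMeasure h) ≤ c ^ 2 * ‖h‖ ^ 2 := by
  have hi : ∀ j, Integrable (fun x => ‖f j x‖ ^ 2) (E.scalarMeasure h) := by
    intro j
    obtain ⟨hm, b, hb⟩ := hf j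
    refine Integrable.of_bound (hm.norm.pow_const 2).aestronglyMeasurable (b ^ 2) ?_
    filter_upwards [ae_le_ae h hb] with x hx
    rw [Real.norm_of_nonneg (by positivity)]
    exact pow_le_pow_left₀ (norm_nonneg _) hx 2
  rw [← integral_finsetSum _ fun j _ => hi j]
  calc _ ≤ ∫ _, c ^ 2 ∂(E.scalarMeasure h) :=
        integral_mono_ae (integrable_finsetSum _ fun j _ => hi j) (integrable_const _)
          (by filter_upwards [ae_le_ae h hc] with x hx using hx s)
    _ = c ^ 2 * ‖h‖ ^ 2 := by
        rw [integral_const, scalarMeasure_real_univ, smul_eq_mul, mul_comm]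

/-- `M ⊗ 1` has no larger norm than `M`: coordinates in an orthonormal basis of the
finite-dimensional span of `y` decouple, and the scalar bound applies to each of them. -/
theorem sum_norm_sq_sum_smul_le {ι κ : Type*} [Fintype ι] [Fintype κ] {M : ι → κ → ℂ} {b : ℝ}
    (hM : ∀ c : κ → ℂ, ∑ j, ‖∑ k, M j k * c k‖ ^ 2 ≤ b ^ 2 * ∑ k, ‖c k‖ ^ 2)
    {K : Type*} [NormedAddCommGroup K] [InnerProductSpace ℂ K] (y : κ → K) :
    ∑ j, ‖∑ k, M j k • y k‖ ^ 2 ≤ b ^ 2 * ∑ k, ‖y k‖ ^ 2 := by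
  set S : Submodule ℂ K := Submodule.span ℂ (Set.range y)
  have hfin : FiniteDimensional ℂ S := FiniteDimensional.span_of_finite ℂ (Set.finite_range y)
  let y' : κ → S := fun k => ⟨y k, Submodule.subset_span ⟨k, rfl⟩⟩
  have h1 : ∀ j, ‖∑ k, M j k • y k‖ = ‖∑ k, M j k • y' k‖ := by
    intro j
    rw [Submodule.coe_norm]
    simp [y']
  have h2 : ∀ k, ‖y k‖ = ‖y' k‖ := fun k => rfl
  let e := stdOrthonormalBasis ℂ S
  simp_rw [h1, h2, ← e.sum_sq_norm_inner_right, inner_sum, inner_smul_right]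
  rw [Finset.sum_comm, Finset.sum_comm (s := (Finset.univ : Finset κ)), Finset.mul_sum]
  exact Finset.sum_le_sum fun l _ => hM fun k => inner ℂ (e l) (y' k)

/-- An essentially bounded matrix function induces a bounded operator matrix: finite matrices. -/
theorem sum_norm_sq_sum_apply_le {ι κ : Type*} [Fintype ι] [Fintype κ] {f : ι → κ → X → ℂ}
    (hf : ∀ j k, Measurable (f j k)) {b : ℝ}
    (hb : ∀ᶠ x in E.ae, ∀ c : κ → ℂ, ∑ j, ‖∑ k, f j k x * c k‖ ^ 2 ≤ b ^ 2 * ∑ k, ‖c k‖ ^ 2)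
    {B : ι → κ → H →L[ℂ] H} (hB : ∀ j k, E.IsIntegral (f j k) (B j k)) (y : κ → H) :
    ∑ j, ‖∑ k, B j k (y k)‖ ^ 2 ≤ b ^ 2 * ∑ k, ‖y k‖ ^ 2 := by
  classical
  -- The matrices of norm at most `b`. Simple approximants with values in `S` satisfy the norm bound
  -- at every point, which entrywise approximation would not ensure.
  set S : Set (ι → κ → ℂ) :=
    {M | ∀ c : κ → ℂ, ∑ j, ‖∑ k, M j k * c k‖ ^ 2 ≤ b ^ 2 * ∑ k, ‖c k‖ ^ 2} with hS
  have hentry : ∀ M ∈ S, ∀ j k, ‖M j k‖ ≤ |b| := by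
    intro M hM j k
    have h1 := hM (Pi.single k 1)
    have h2 : ‖M j k‖ ^ 2 ≤ b ^ 2 := by
      calc ‖M j k‖ ^ 2 ≤ ∑ j, ‖M j k‖ ^ 2 :=
            Finset.single_le_sum (f := fun j => ‖M j k‖ ^ 2) (fun _ _ => by positivity)
              (Finset.mem_univ j)
        _ ≤ b ^ 2 := by
          have h3 : ∑ i, ‖(Pi.single k (1 : ℂ) : κ → ℂ) i‖ ^ 2 = 1 := by
            rw [Finset.sum_eq_single k]
            · simp
            · intro i _ hi
              simp [Pi.single_eq_of_ne hi]
            · simp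
          rw [h3, mul_one] at h1
          simpa [Pi.single_apply] using h1
    exact (abs_norm (M j k)).symm ▸ sq_le_sq.1 h2
  have h0 : (0 : ι → κ → ℂ) ∈ S := by
    intro c
    calc _ = (0 : ℝ) := by simp
      _ ≤ _ := by positivity
  let f' : X → ι → κ → ℂ := fun x j k => f j k x
  have hm : Measurable f' := measurable_pi_iff.2 fun j => measurable_pi_iff.2 fun k => hf j k
  have hmem : ∀ᶠ x in E.ae, f' x ∈ S := hb
  set F : ℕ → SimpleFunc X (ι → κ → ℂ) := SimpleFunc.approxOn f' hm S 0 h0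
  have hFS : ∀ n x, F n x ∈ S := fun n x => SimpleFunc.approxOn_mem hm h0 n x
  set A : ℕ → ι → κ → H →L[ℂ] H := fun n j k => E.simpleIntegral (F n) fun M => M j k
  have hAlim : ∀ j k h, Tendsto (fun n => A n j k h) atTop (𝓝 (B j k h)) := by
    intro j k h
    refine tendsto_apply_of_dominated (c := |b|)
      (fun n => E.isIntegral_simpleIntegral (F n) fun M => M j k) (hB j k) (fun n => ?_) (hf j k)
      (fun n => Eventually.of_forall fun x => hentry _ (hFS n x) j k)
      (hmem.mono fun x hx => hentry _ hx j k) ?_ h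
    · exact (measurable_pi_apply k).comp ((measurable_pi_apply j).comp (F n).measurable)
    · filter_upwards [hmem] with x hx
      have := SimpleFunc.tendsto_approxOn hm h0 (subset_closure hx)
      exact (tendsto_pi_nhds.1 ((tendsto_pi_nhds.1 this) j)) k
  have hAle : ∀ n, ∑ j, ‖∑ k, A n j k (y k)‖ ^ 2 ≤ b ^ 2 * ∑ k, ‖y k‖ ^ 2 := by
    intro n
    -- Each value `M` acts on the range of its own spectral projection. These ranges are orthogonal,
    -- so the estimate splits into one scalar matrix at a time.
    have h1 : ∀ j, ∑ k, A n j k (y k) =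
        ∑ M ∈ (F n).range, E.proj (F n ⁻¹' {M}) (∑ k, M j k • y k) := by
      intro j
      simp only [A, simpleIntegral_apply, map_sum]
      rw [Finset.sum_comm]
    simp_rw [h1, norm_sq_sum_proj]
    rw [Finset.sum_comm]
    have h2 : ∀ k, ∑ M ∈ (F n).range, ‖E.proj (F n ⁻¹' {M}) (y k)‖ ^ 2 = ‖y k‖ ^ 2 := by
      intro k
      have h3 := integral_simpleFunc (E.scalarMeasure (y k)) (F n) (fun _ => (1 : ℝ))
      rw [integral_const, scalarMeasure_real_univ, smul_eq_mul, mul_one] at h3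
      rw [h3]
      refine Finset.sum_congr rfl fun M _ => ?_
      rw [E.scalarMeasure_real_apply _ ((F n).measurableSet_fiber M), smul_eq_mul, mul_one]
    simp_rw [← h2]
    rw [Finset.sum_comm (s := (Finset.univ : Finset κ)), Finset.mul_sum]
    refine Finset.sum_le_sum fun M hM => ?_
    simp only [map_sum, map_smul]
    obtain ⟨x, rfl⟩ := SimpleFunc.mem_range.1 hM
    exact sum_norm_sq_sum_smul_le (hFS n x) _
  have hlim : Tendsto (fun n => ∑ j, ‖∑ k, A n j k (y k)‖ ^ 2) atTop
      (𝓝 (∑ j, ‖∑ k, B j k (y k)‖ ^ 2)) :=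
    tendsto_finsetSum _ fun j _ =>
      (tendsto_finsetSum _ fun k _ => hAlim j k (y k)).norm.pow 2
  exact le_of_tendsto hlim (Eventually.of_forall hAle)

end SpectralMeasure

/-! ### The space `ℓ²(H)`: ampliations, truncations, operator columns and operator matrices. -/

section Sequences

variable {H : Type v} [NormedAddCommGroup H]

/-- The Hilbert space `ℓ²(H)`. -/
abbrev SeqSpace (H : Type v) [NormedAddCommGroup H] : Type v := lp (fun _ : ℕ => H) 2

theorem memℓp_two_of_sum_le {f : ℕ → H} {C : ℝ} (hf : ∀ s : Finset ℕ, ∑ j ∈ s, ‖f j‖ ^ 2 ≤ C) :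
    Memℓp f 2 :=
  memℓp_gen' (C := C) fun s => by simpa using hf s

theorem SeqSpace.norm_le {f : SeqSpace H} {C : ℝ} (hC : 0 ≤ C)
    (hf : ∀ s : Finset ℕ, ∑ j ∈ s, ‖f j‖ ^ 2 ≤ C ^ 2) : ‖f‖ ≤ C :=
  lp.norm_le_of_forall_sum_le (by simp) hC fun s => by simpa using hf s

theorem SeqSpace.sum_le (f : SeqSpace H) (s : Finset ℕ) : ∑ j ∈ s, ‖f j‖ ^ 2 ≤ ‖f‖ ^ 2 := by
  simpa using lp.sum_rpow_le_norm_rpow (p := 2) (by simp) f s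

theorem SeqSpace.hasSum_norm_sq (f : SeqSpace H) : HasSum (fun j => ‖f j‖ ^ 2) (‖f‖ ^ 2) := by
  simpa using lp.hasSum_norm (p := 2) (by simp) f

variable [InnerProductSpace ℂ H]

/-- Common source of the ampliations, truncations, columns and matrix operators below: an operator
into `ℓ²(H)` is built from its coordinates and a bound on finite partial sums. -/
theorem exists_seqSpace_clm {W : Type*} [NormedAddCommGroup W] [NormedSpace ℂ W]
    (φ : ℕ → W →ₗ[ℂ] H) {c : ℝ} (hc : 0 ≤ c)
    (h : ∀ x (s : Finset ℕ), ∑ j ∈ s, ‖φ j x‖ ^ 2 ≤ c ^ 2 * ‖x‖ ^ 2) :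
    ∃ Φ : W →L[ℂ] SeqSpace H, ‖Φ‖ ≤ c ∧ ∀ x j, Φ x j = φ j x := by
  let L : W →ₗ[ℂ] SeqSpace H :=
    { toFun := fun x => ⟨fun j => φ j x, memℓp_two_of_sum_le (h x)⟩
      map_add' := fun x y => by
        apply lp.ext
        funext j
        exact map_add (φ j) x y
      map_smul' := fun a x => by
        apply lp.ext
        funext j
        exact map_smul (φ j) a x }
  have hL : ∀ x, ‖L x‖ ≤ c * ‖x‖ := fun x =>
    SeqSpace.norm_le (by positivity) fun s => (h x s).trans_eq (by ring)
  exact ⟨L.mkContinuous c hL, L.mkContinuous_norm_le hc hL, fun x j => rfl⟩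

theorem exists_amp (T : H →L[ℂ] H) :
    ∃ Φ : SeqSpace H →L[ℂ] SeqSpace H, ‖Φ‖ ≤ ‖T‖ ∧ ∀ x j, Φ x j = T (x j) := by
  refine exists_seqSpace_clm
    (fun j => (T : H →ₗ[ℂ] H) ∘ₗ (lp.evalₗ (𝕜 := ℂ) (fun _ : ℕ => H) 2 j)) (norm_nonneg T)
    fun x s => ?_
  calc _ ≤ ∑ j ∈ s, ‖T‖ ^ 2 * ‖x j‖ ^ 2 := Finset.sum_le_sum fun j _ => by
        rw [← mul_pow]
        exact pow_le_pow_left₀ (norm_nonneg _) (T.le_opNorm _) 2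
    _ ≤ _ := by
        rw [← Finset.mul_sum]
        exact mul_le_mul_of_nonneg_left (SeqSpace.sum_le x s) (by positivity)

/-- The ampliation `T ⊗ 1` on `ℓ²(H)`. -/
def amp (T : H →L[ℂ] H) : SeqSpace H →L[ℂ] SeqSpace H := (exists_amp T).choose

theorem norm_amp_le (T : H →L[ℂ] H) : ‖amp T‖ ≤ ‖T‖ := (exists_amp T).choose_spec.1

@[simp]
theorem amp_apply (T : H →L[ℂ] H) (x : SeqSpace H) (j : ℕ) : amp T x j = T (x j) :=
  (exists_amp T).choose_spec.2 x j

/-- The ampliation as a linear map. -/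
def ampLinear : (H →L[ℂ] H) →ₗ[ℂ] (SeqSpace H →L[ℂ] SeqSpace H) where
  toFun := amp
  map_add' S T := by
    ext x j
    simp
  map_smul' a T := by
    ext x j
    simp

theorem exists_trunc (H : Type v) [NormedAddCommGroup H] [InnerProductSpace ℂ H] (N : ℕ) :
    ∃ Φ : SeqSpace H →L[ℂ] SeqSpace H, ‖Φ‖ ≤ 1 ∧ ∀ x j, Φ x j = if j < N then x j else 0 := by
  let φ : ℕ → SeqSpace H →ₗ[ℂ] H := fun j =>
    if j < N then lp.evalₗ (𝕜 := ℂ) (fun _ : ℕ => H) 2 j else 0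
  have hφ : ∀ j x, φ j x = if j < N then x j else 0 := by
    intro j x
    simp only [φ]
    split_ifs <;> rfl
  have h : ∀ x (s : Finset ℕ), ∑ j ∈ s, ‖φ j x‖ ^ 2 ≤ 1 ^ 2 * ‖x‖ ^ 2 := by
    intro x s
    rw [one_pow, one_mul]
    refine (Finset.sum_le_sum fun j _ => ?_).trans (SeqSpace.sum_le x s)
    rw [hφ]
    split_ifs
    · rfl
    · rw [norm_zero]
      exact pow_le_pow_left₀ le_rfl (norm_nonneg _) 2
  obtain ⟨Φ, h1, h2⟩ := exists_seqSpace_clm φ zero_le_one h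
  exact ⟨Φ, h1, fun x j => (h2 x j).trans (hφ j x)⟩

/-- The projection of `ℓ²(H)` onto the first `N` coordinates. -/
def trunc (H : Type v) [NormedAddCommGroup H] [InnerProductSpace ℂ H] (N : ℕ) :
    SeqSpace H →L[ℂ] SeqSpace H := (exists_trunc H N).choose

theorem norm_trunc_le (N : ℕ) : ‖trunc H N‖ ≤ 1 := (exists_trunc H N).choose_spec.1

@[simp]
theorem trunc_apply (N : ℕ) (x : SeqSpace H) (j : ℕ) :
    trunc H N x j = if j < N then x j else 0 :=
  (exists_trunc H N).choose_spec.2 x j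

theorem tendsto_trunc (x : SeqSpace H) : Tendsto (fun N => trunc H N x) atTop (𝓝 x) := by
  have h1 := (lp.hasSum_single (p := 2) (by simp) x).tendsto_sum_nat
  refine h1.congr fun N => ?_
  apply lp.ext
  funext j
  rw [lp.coeFn_sum, Finset.sum_apply, trunc_apply]
  simp only [lp.single_apply]
  by_cases hj : j < N
  · rw [if_pos hj, Finset.sum_eq_single j]
    · simp
    · intro k _ hk
      simp [Pi.single_eq_of_ne (Ne.symm hk)]
    · simp [hj]
  · rw [if_neg hj]
    refine Finset.sum_eq_zero fun k hk => ?_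
    refine Pi.single_eq_of_ne ?_ _
    rintro rfl
    exact hj (Finset.mem_range.1 hk)

/-- The operator matrix `(B j k)` is bounded on `ℓ²(H)` with norm at most `b`. -/
def BoundedMatrix (b : ℝ) (B : ℕ → ℕ → H →L[ℂ] H) : Prop :=
  ∀ (s t : Finset ℕ) (y : ℕ → H),
    ∑ j ∈ s, ‖∑ k ∈ t, B j k (y k)‖ ^ 2 ≤ b ^ 2 * ∑ k ∈ t, ‖y k‖ ^ 2

/-- The operator column `(G j)` is bounded from `H` to `ℓ²(H)` with norm at most `c`. -/
def BoundedColumn (c : ℝ) (G : ℕ → H →L[ℂ] H) : Prop :=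
  ∀ (s : Finset ℕ) (h : H), ∑ j ∈ s, ‖G j h‖ ^ 2 ≤ c ^ 2 * ‖h‖ ^ 2

theorem BoundedColumn.exists_clm {c : ℝ} (hc : 0 ≤ c) {G : ℕ → H →L[ℂ] H}
    (hG : BoundedColumn c G) :
    ∃ Φ : H →L[ℂ] SeqSpace H, ‖Φ‖ ≤ c ∧ ∀ x j, Φ x j = G j x :=
  exists_seqSpace_clm (fun j => (G j : H →ₗ[ℂ] H)) hc fun x s => hG s x

theorem BoundedMatrix.summable [CompleteSpace H] {b : ℝ} {B : ℕ → ℕ → H →L[ℂ] H}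
    (hB : BoundedMatrix b B) (x : SeqSpace H) (j : ℕ) : Summable fun k => B j k (x k) := by
  rw [summable_iff_vanishing_norm]
  intro ε hε
  have hs := (SeqSpace.hasSum_norm_sq x).summable
  rw [summable_iff_vanishing_norm] at hs
  -- The summand `1` keeps the denominator positive when `b = 0`.
  obtain ⟨s, hs⟩ := hs (ε ^ 2 / (b ^ 2 + 1)) (by positivity)
  refine ⟨s, fun t ht => ?_⟩
  have h1 := hB {j} t x
  rw [Finset.sum_singleton] at h1
  have h2 := (le_abs_self _).trans_lt (hs t ht)
  rw [lt_div_iff₀ (by positivity)] at h2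
  have h3 : 0 ≤ ∑ k ∈ t, ‖x k‖ ^ 2 := by positivity
  refine lt_of_pow_lt_pow_left₀ 2 hε.le ?_
  nlinarith

theorem BoundedMatrix.exists_clm [CompleteSpace H] {b : ℝ} (hb : 0 ≤ b) {B : ℕ → ℕ → H →L[ℂ] H}
    (hB : BoundedMatrix b B) :
    ∃ Φ : SeqSpace H →L[ℂ] SeqSpace H, ‖Φ‖ ≤ b ∧
      ∀ x j, HasSum (fun k => B j k (x k)) (Φ x j) := by
  let φ : ℕ → SeqSpace H →ₗ[ℂ] H := fun j =>
    { toFun := fun x => ∑' k, B j k (x k)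
      map_add' := fun x y => by
        rw [← (hB.summable x j).tsum_add (hB.summable y j)]
        simp
      map_smul' := fun a x => by
        rw [RingHom.id_apply, ← tsum_const_smul'']
        simp }
  have h : ∀ x (s : Finset ℕ), ∑ j ∈ s, ‖φ j x‖ ^ 2 ≤ b ^ 2 * ‖x‖ ^ 2 := by
    intro x s
    have h3 : Tendsto (fun t : Finset ℕ => ∑ j ∈ s, ‖∑ k ∈ t, B j k (x k)‖ ^ 2) atTop
        (𝓝 (∑ j ∈ s, ‖φ j x‖ ^ 2)) :=
      tendsto_finsetSum _ fun j _ => ((hB.summable x j).hasSum.norm.pow 2)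
    refine le_of_tendsto h3 (Eventually.of_forall fun t => (hB s t x).trans ?_)
    exact mul_le_mul_of_nonneg_left (SeqSpace.sum_le x t) (by positivity)
  obtain ⟨Φ, h1, h2⟩ := exists_seqSpace_clm φ hb h
  refine ⟨Φ, h1, fun x j => ?_⟩
  rw [h2]
  exact (hB.summable x j).hasSum

end Sequences

/-! ### Norms and strong limits of finite products; sums over boxes. -/

section Products

variable {K : Type*} [NormedAddCommGroup K] [NormedSpace ℂ K]

theorem norm_ofFn_prod_le {n : ℕ} {F : Fin n → K →L[ℂ] K} {c : Fin n → ℝ}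
    (h : ∀ i, ‖F i‖ ≤ c i) : ‖(List.ofFn F).prod‖ ≤ ∏ i, c i := by
  induction n with
  | zero =>
    rw [List.ofFn_zero, List.prod_nil, Finset.univ_eq_empty, Finset.prod_empty]
    exact ContinuousLinearMap.norm_id_le
  | succ n ih =>
    rw [List.ofFn_succ, List.prod_cons, Fin.prod_univ_succ]
    exact (norm_mul_le _ _).trans (mul_le_mul (h 0) (ih fun i => h i.succ) (norm_nonneg _)
      ((norm_nonneg _).trans (h 0)))

/-- The uniform bound allows the argument to vary with the operator, which makes products of bounded
strongly convergent families converge strongly. -/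
theorem tendsto_clm_apply {ι : Type*} {l : Filter ι} {W : Type*} [NormedAddCommGroup W]
    [NormedSpace ℂ W] {F : ι → K →L[ℂ] W} {A : K →L[ℂ] W}
    {C : ℝ} (hC : ∀ N, ‖F N‖ ≤ C) (hF : ∀ x, Tendsto (fun N => F N x) l (𝓝 (A x)))
    {y : ι → K} {z : K} (hy : Tendsto y l (𝓝 z)) : Tendsto (fun N => F N (y N)) l (𝓝 (A z)) := by
  have h1 : Tendsto (fun N => F N (y N - z)) l (𝓝 0) := by
    rw [tendsto_zero_iff_norm_tendsto_zero]
    have h2 : Tendsto (fun N => C * ‖y N - z‖) l (𝓝 0) := by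
      simpa using (tendsto_iff_norm_sub_tendsto_zero.1 hy).const_mul C
    exact squeeze_zero (fun _ => norm_nonneg _)
      (fun N => (F N).le_of_opNorm_le (hC N) _) h2
  simpa using h1.add (hF z)

theorem tendsto_ofFn_prod_apply {ι : Type*} {l : Filter ι} {n : ℕ} {F : ι → Fin n → K →L[ℂ] K}
    {A : Fin n → K →L[ℂ] K} {C : Fin n → ℝ} (hC : ∀ N i, ‖F N i‖ ≤ C i)
    (hF : ∀ i x, Tendsto (fun N => F N i x) l (𝓝 (A i x))) (x : K) :
    Tendsto (fun N => (List.ofFn (F N)).prod x) l (𝓝 ((List.ofFn A).prod x)) := by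
  induction n with
  | zero => simpa using tendsto_const_nhds
  | succ n ih =>
    simp only [List.ofFn_succ, List.prod_cons, mul_apply_eq_comp]
    exact tendsto_clm_apply (fun N => hC N 0) (hF 0)
      (ih (fun N i => hC N i.succ) (fun i => hF i.succ))

theorem sum_piFinset_succ {n : ℕ} {ι M : Type*} [AddCommMonoid M] (S : Fin (n + 1) → Finset ι)
    (f : (Fin (n + 1) → ι) → M) :
    ∑ j ∈ Fintype.piFinset S, f j =
      ∑ k ∈ S 0, ∑ j ∈ Fintype.piFinset (fun i : Fin n => S i.succ), f (Fin.cons k j) := by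
  rw [← Finset.sum_product']
  refine Finset.sum_bij' (fun j _ => (j 0, Fin.tail j)) (fun p _ => Fin.cons p.1 p.2) ?_ ?_ ?_ ?_ ?_
  · intro j hj
    rw [Fintype.mem_piFinset] at hj
    rw [Finset.mem_product, Fintype.mem_piFinset]
    exact ⟨hj 0, fun i => hj i.succ⟩
  · rintro ⟨k, j⟩ hj
    rw [Finset.mem_product, Fintype.mem_piFinset] at hj
    rw [Fintype.mem_piFinset]
    intro i
    refine Fin.cases ?_ (fun i => ?_) i
    · exact hj.1
    · exact hj.2 i
  · intro j _
    exact Fin.cons_self_tail j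
  · rintro ⟨k, j⟩ _
    simp
  · intro j _
    simp

end Products

/-! ### Box sums as truncated products on `ℓ²(H)`. -/

section Chain

variable {H : Type v} [NormedAddCommGroup H] [InnerProductSpace ℂ H]

/-- A truncation after each matrix operator turns its row series into a finite sum. The leftmost
index `a` stays free, as the induction and the later pairing with `V` require; `Fin.cons a j` is the
full index path. -/
theorem chain_apply {n : ℕ} {B : Fin n → ℕ → ℕ → H →L[ℂ] H}
    {Bop : Fin n → SeqSpace H →L[ℂ] SeqSpace H}
    (hB : ∀ i x j, HasSum (fun k => B i j k (x k)) (Bop i x j))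
    (T : Fin n → H →L[ℂ] H) (N : Fin n → ℕ) (z : SeqSpace H) (a : ℕ) :
    (List.ofFn fun i => Bop i * trunc H (N i) * amp (T i)).prod z a =
      ∑ j ∈ Fintype.piFinset fun i => Finset.range (N i),
        (List.ofFn fun i => B i ((Fin.cons a j : Fin (n + 1) → ℕ) i.castSucc)
          ((Fin.cons a j : Fin (n + 1) → ℕ) i.succ) * T i).prod
          (z ((Fin.cons a j : Fin (n + 1) → ℕ) (Fin.last n))) := by
  induction n generalizing a with
  | zero => simp
  | succ n ih =>
    rw [sum_piFinset_succ]
    simp only [List.ofFn_succ, List.prod_cons, mul_apply_eq_comp]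
    set w := (List.ofFn fun i : Fin n => Bop i.succ * trunc H (N i.succ) * amp (T i.succ)).prod z
      with hw
    have h1 : Bop 0 (trunc H (N 0) (amp (T 0) w)) a =
        ∑ k ∈ Finset.range (N 0), B 0 a k (T 0 (w k)) := by
      refine (hB 0 (trunc H (N 0) (amp (T 0) w)) a).unique ?_
      have h2 : ∀ k ∈ Finset.range (N 0),
          B 0 a k (T 0 (w k)) = B 0 a k (trunc H (N 0) (amp (T 0) w) k) := by
        intro k hk
        rw [trunc_apply, if_pos (Finset.mem_range.1 hk), amp_apply]
      rw [Finset.sum_congr rfl h2]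
      refine hasSum_sum_of_ne_finset_zero fun k hk => ?_
      rw [trunc_apply, if_neg (by simpa using hk), map_zero]
    rw [h1]
    refine Finset.sum_congr rfl fun k _ => ?_
    rw [hw, ih (fun i => hB i.succ) (fun i => T i.succ) (fun i => N i.succ) k, map_sum, map_sum]
    rfl

/-- The box sum `∑ A_{j₀} T₀ B⁽¹⁾_{j₀j₁} T₁ ⋯ B⁽ⁿ⁾_{j_{n-1}j_n} T_n G_{j_n}`. -/
def boxSum {n : ℕ} (A : ℕ → H →L[ℂ] H) (B : Fin n → ℕ → ℕ → H →L[ℂ] H) (G : ℕ → H →L[ℂ] H)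
    (T : Fin (n + 1) → H →L[ℂ] H) (N : Fin (n + 1) → ℕ) : H →L[ℂ] H :=
  ∑ j ∈ Fintype.piFinset fun i => Finset.range (N i),
    A (j 0) * T 0 * (List.ofFn fun i : Fin n => B i (j i.castSucc) (j i.succ) * T i.succ).prod *
      G (j (Fin.last n))

variable [CompleteSpace H]

theorem inner_boxSum {n : ℕ} {A G : ℕ → H →L[ℂ] H} {B : Fin n → ℕ → ℕ → H →L[ℂ] H}
    {V W : H →L[ℂ] SeqSpace H} {Bop : Fin n → SeqSpace H →L[ℂ] SeqSpace H}
    (hV : ∀ x j, V x j = ContinuousLinearMap.adjoint (A j) x)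
    (hW : ∀ x j, W x j = G j x)
    (hB : ∀ i x j, HasSum (fun k => B i j k (x k)) (Bop i x j))
    (T : Fin (n + 1) → H →L[ℂ] H) (N : Fin (n + 1) → ℕ) (g h : H) :
    inner ℂ g (boxSum A B G T N h) =
      inner ℂ (V g) (trunc H (N 0) (amp (T 0)
        ((List.ofFn fun i => Bop i * trunc H (N i.succ) * amp (T i.succ)).prod (W h)))) := by
  set w := (List.ofFn fun i => Bop i * trunc H (N i.succ) * amp (T i.succ)).prod (W h) with hw
  have h1 : inner ℂ (V g) (trunc H (N 0) (amp (T 0) w)) =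
      ∑ a ∈ Finset.range (N 0), inner ℂ g (A a (T 0 (w a))) := by
    refine (lp.hasSum_inner (V g) (trunc H (N 0) (amp (T 0) w))).unique ?_
    have h2 : ∀ k ∈ Finset.range (N 0), inner ℂ g (A k (T 0 (w k))) =
        inner ℂ (V g k) (trunc H (N 0) (amp (T 0) w) k) := by
      intro k hk
      rw [trunc_apply, if_pos (Finset.mem_range.1 hk), amp_apply, hV,
        ContinuousLinearMap.adjoint_inner_left]
    rw [Finset.sum_congr rfl h2]
    refine hasSum_sum_of_ne_finset_zero fun k hk => ?_
    rw [trunc_apply, if_neg (by simpa using hk), inner_zero_right]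
  rw [h1, boxSum, sum_piFinset_succ, sum_apply, inner_sum]
  refine Finset.sum_congr rfl fun a _ => ?_
  rw [hw, chain_apply hB, map_sum, map_sum, sum_apply]
  congr 1
  refine Finset.sum_congr rfl fun j _ => ?_
  rw [hW]
  rfl

/-- The operator `V* (T₀ ⊗ 1) Bop₁ (T₁ ⊗ 1) ⋯ Bop_n (T_n ⊗ 1) W`. -/
def chainOp {n : ℕ} (V W : H →L[ℂ] SeqSpace H) (Bop : Fin n → SeqSpace H →L[ℂ] SeqSpace H)
    (T : Fin (n + 1) → H →L[ℂ] H) : H →L[ℂ] H :=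
  ContinuousLinearMap.adjoint V ∘L amp (T 0) ∘L
    (List.ofFn fun i => Bop i * amp (T i.succ)).prod ∘L W

theorem inner_chainOp {n : ℕ} (V W : H →L[ℂ] SeqSpace H)
    (Bop : Fin n → SeqSpace H →L[ℂ] SeqSpace H) (T : Fin (n + 1) → H →L[ℂ] H) (g h : H) :
    inner ℂ g (chainOp V W Bop T h) =
      inner ℂ (V g) (amp (T 0) ((List.ofFn fun i => Bop i * amp (T i.succ)).prod (W h))) := by
  simp only [chainOp, ContinuousLinearMap.comp_apply]
  rw [ContinuousLinearMap.adjoint_inner_right]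

/-- By `inner_boxSum` the box enters only through the truncations, which are contractions converging
strongly to the identity; removing them gives `chainOp`. -/
theorem tendsto_inner_boxSum {n : ℕ} {A G : ℕ → H →L[ℂ] H} {B : Fin n → ℕ → ℕ → H →L[ℂ] H}
    {V W : H →L[ℂ] SeqSpace H} {Bop : Fin n → SeqSpace H →L[ℂ] SeqSpace H}
    (hV : ∀ x j, V x j = ContinuousLinearMap.adjoint (A j) x)
    (hW : ∀ x j, W x j = G j x)
    (hB : ∀ i x j, HasSum (fun k => B i j k (x k)) (Bop i x j))
    (T : Fin (n + 1) → H →L[ℂ] H) (g h : H) :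
    Tendsto (fun N => inner ℂ g (boxSum A B G T N h)) atTop
      (𝓝 (inner ℂ g (chainOp V W Bop T h))) := by
  simp_rw [inner_boxSum hV hW hB, inner_chainOp]
  have hN : ∀ i (x : SeqSpace H),
      Tendsto (fun N : Fin (n + 1) → ℕ => trunc H (N i) x) atTop (𝓝 x) := fun i x =>
    (tendsto_trunc x).comp (tendsto_atTop.2 fun m =>
      (eventually_ge_atTop (fun _ => m)).mono fun N hN => hN i)
  refine tendsto_const_nhds.inner ?_
  refine tendsto_clm_apply (F := fun N : Fin (n + 1) → ℕ => trunc H (N 0))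
    (A := ContinuousLinearMap.id ℂ _) (fun N => norm_trunc_le _) (hN 0) ?_
  refine ((amp (T 0)).continuous.tendsto _).comp ?_
  refine tendsto_ofFn_prod_apply (C := fun i => ‖Bop i‖ * 1 * ‖amp (T i.succ)‖) ?_ ?_ _
  · intro N i
    refine (norm_mul_le _ _).trans (mul_le_mul_of_nonneg_right ?_ (norm_nonneg _))
    exact (norm_mul_le _ _).trans (mul_le_mul_of_nonneg_left (norm_trunc_le _) (norm_nonneg _))
  · intro i x
    exact ((Bop i).continuous.tendsto _).comp (hN i.succ (amp (T i.succ) x))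

/-- Serves with `H = ℂ`, where it bounds the scalar partial sums of a representation uniformly in
the box. -/
theorem norm_inner_boxSum_le {n : ℕ} {A G : ℕ → H →L[ℂ] H} {B : Fin n → ℕ → ℕ → H →L[ℂ] H}
    {a c : ℝ} {b : Fin n → ℝ} (ha : 0 ≤ a) (hc : 0 ≤ c) (hb : ∀ i, 0 ≤ b i)
    (hA : BoundedColumn a fun j => ContinuousLinearMap.adjoint (A j)) (hG : BoundedColumn c G)
    (hB : ∀ i, BoundedMatrix (b i) (B i)) (N : Fin (n + 1) → ℕ) (g h : H) :
    ‖inner ℂ g (boxSum A B G (fun _ => 1) N h)‖ ≤ a * (∏ i, b i) * c * (‖g‖ * ‖h‖) := by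
  obtain ⟨V, hVn, hV⟩ := hA.exists_clm ha
  obtain ⟨W, hWn, hW⟩ := hG.exists_clm hc
  choose Bop hBn hB' using fun i => (hB i).exists_clm (hb i)
  rw [inner_boxSum hV hW hB']
  have hamp : ‖amp (1 : H →L[ℂ] H)‖ ≤ 1 :=
    (norm_amp_le _).trans ContinuousLinearMap.norm_id_le
  refine (norm_inner_le_norm _ _).trans ?_
  have h1 : ‖V g‖ ≤ a * ‖g‖ := V.le_of_opNorm_le hVn g
  have h2 : ‖W h‖ ≤ c * ‖h‖ := W.le_of_opNorm_le hWn h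
  have h3 : ‖(List.ofFn fun i => Bop i * trunc H (N i.succ) * amp (1 : H →L[ℂ] H)).prod‖ ≤
      ∏ i, b i := by
    refine norm_ofFn_prod_le fun i => ?_
    calc _ ≤ ‖Bop i‖ * ‖trunc H (N i.succ)‖ * ‖amp (1 : H →L[ℂ] H)‖ :=
          (norm_mul_le _ _).trans (mul_le_mul_of_nonneg_right (norm_mul_le _ _) (norm_nonneg _))
      _ ≤ b i * 1 * 1 := by
          gcongr
          · exact mul_nonneg (hb i) zero_le_one
          · exact hb i
          · exact hBn i
          · exact norm_trunc_le _
      _ = b i := by ring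
  have h4 : ∀ y : SeqSpace H, ‖trunc H (N 0) (amp (1 : H →L[ℂ] H) y)‖ ≤ ‖y‖ := fun y => by
    have h5 := (trunc H (N 0)).le_of_opNorm_le (norm_trunc_le _) (amp (1 : H →L[ℂ] H) y)
    have h6 := (amp (1 : H →L[ℂ] H)).le_of_opNorm_le hamp y
    linarith
  have hbp : 0 ≤ ∏ i, b i := Finset.prod_nonneg fun i _ => hb i
  calc _ ≤ (a * ‖g‖) * ((∏ i, b i) * (c * ‖h‖)) := by
        refine mul_le_mul h1 ((h4 _).trans ?_) (norm_nonneg _) (by positivity)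
        refine (ContinuousLinearMap.le_of_opNorm_le _ h3 _).trans ?_
        exact mul_le_mul_of_nonneg_left h2 hbp
    _ = _ := by ring

end Chain

/-! ### Pointwise bounds for scalar rows, matrices and columns. -/

section ScalarBounds

theorem sum_norm_sq_le_of_seqENorm_le {a : ℕ → ℂ} {c : ℝ≥0∞} (hc : c ≠ ∞) (h : seqENorm a ≤ c)
    (s : Finset ℕ) : ∑ j ∈ s, ‖a j‖ ^ 2 ≤ c.toReal ^ 2 := by
  have h1 : ∑' j, ‖a j‖ₑ ^ 2 ≤ c ^ 2 := by
    have h2 := ENNReal.rpow_le_rpow h (z := 2) (by norm_num)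
    rw [seqENorm, ← ENNReal.rpow_mul] at h2
    simpa using h2
  have h2 := (ENNReal.sum_le_tsum s).trans h1
  have h3 := ENNReal.toReal_mono (by finiteness) h2
  rw [ENNReal.toReal_sum (fun j _ => by finiteness)] at h3
  simpa using h3

theorem sum_norm_sq_le_of_matrixENorm_le {m : ℕ → ℕ → ℂ} {b : ℝ≥0∞} (hb : b ≠ ∞)
    (h : matrixENorm m ≤ b) (s t : Finset ℕ) (c : ℕ → ℂ) :
    ∑ j ∈ s, ‖∑ k ∈ t, m j k * c k‖ ^ 2 ≤ b.toReal ^ 2 * ∑ k ∈ t, ‖c k‖ ^ 2 := by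
  -- A finite infimum in `ℝ≥0∞` cannot be taken over an empty family.
  have hex : ∃ B : lp (fun _ : ℕ => ℂ) 2 →L[ℂ] lp (fun _ : ℕ => ℂ) 2,
      ∀ j k, B (lp.single 2 k (1 : ℂ)) j = m j k := by
    by_contra hne
    push Not at hne
    have : matrixENorm m = ∞ := by
      refine iInf₂_eq_top.2 fun B hB => ?_
      obtain ⟨j, k, hjk⟩ := hne B
      exact absurd (hB j k) hjk
    rw [this, top_le_iff] at h
    exact hb h
  obtain ⟨B, hB⟩ := hex
  have hBn : ‖B‖ ≤ b.toReal := by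
    -- An operator on `ℓ²` is determined by its values on the unit vectors, so all competitors in
    -- the infimum coincide.
    have h1 : ‖B‖ₑ ≤ matrixENorm m := by
      refine le_iInf₂ fun B' hB' => le_of_eq ?_
      congr 1
      refine lp.ext_continuousLinearMap (by simp) fun k => ?_
      ext j
      simp [hB, hB']
    have h2 := ENNReal.toReal_mono hb (h1.trans h)
    simpa using h2
  set y : lp (fun _ : ℕ => ℂ) 2 := ∑ k ∈ t, c k • lp.single 2 k (1 : ℂ) with hy
  have h1 : ∀ j, B y j = ∑ k ∈ t, m j k * c k := by
    intro j
    rw [hy, map_sum, lp.coeFn_sum, Finset.sum_apply]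
    refine Finset.sum_congr rfl fun k _ => ?_
    rw [map_smul, lp.coeFn_smul, Pi.smul_apply, hB, smul_eq_mul, mul_comm]
  have h2 : ‖y‖ ^ 2 = ∑ k ∈ t, ‖c k‖ ^ 2 := by
    have h3 := lp.norm_sum_single (p := 2) (E := fun _ : ℕ => ℂ) (by simp) c t
    have h4 : y = ∑ k ∈ t, lp.single 2 k (c k) := by
      refine Finset.sum_congr rfl fun k _ => ?_
      rw [← lp.single_smul, smul_eq_mul, mul_one]
    rw [h4]
    simpa using h3
  simp_rw [← h1]
  rw [← h2, ← mul_pow]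
  exact (SeqSpace.sum_le (B y) s).trans
    (pow_le_pow_left₀ (norm_nonneg _) (B.le_of_opNorm_le hBn y) 2)

theorem boundedColumn_smul_one {a : ℕ → ℂ} {c : ℝ}
    (h : ∀ s : Finset ℕ, ∑ j ∈ s, ‖a j‖ ^ 2 ≤ c ^ 2) :
    BoundedColumn c fun j => a j • (1 : ℂ →L[ℂ] ℂ) := by
  intro s x
  simp only [smul_apply, one_apply_eq_self, norm_smul, mul_pow]
  rw [← Finset.sum_mul]
  exact mul_le_mul_of_nonneg_right (h s) (by positivity)

/-- The partial sums of a product of a bounded row, bounded matrices and a bounded column. -/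
theorem norm_sum_piFinset_le {n : ℕ} {α γ : ℕ → ℂ} {β : Fin n → ℕ → ℕ → ℂ} {a c : ℝ}
    {b : Fin n → ℝ} (ha : 0 ≤ a) (hc : 0 ≤ c) (hb : ∀ i, 0 ≤ b i)
    (hα : ∀ s : Finset ℕ, ∑ j ∈ s, ‖α j‖ ^ 2 ≤ a ^ 2)
    (hγ : ∀ s : Finset ℕ, ∑ j ∈ s, ‖γ j‖ ^ 2 ≤ c ^ 2)
    (hβ : ∀ i (s t : Finset ℕ) (y : ℕ → ℂ),
      ∑ j ∈ s, ‖∑ k ∈ t, β i j k * y k‖ ^ 2 ≤ b i ^ 2 * ∑ k ∈ t, ‖y k‖ ^ 2)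
    (N : Fin (n + 1) → ℕ) :
    ‖∑ j ∈ Fintype.piFinset fun i => Finset.range (N i),
      α (j 0) * (∏ i : Fin n, β i (j i.castSucc) (j i.succ)) * γ (j (Fin.last n))‖ ≤
      a * (∏ i, b i) * c := by
  have h1 := norm_inner_boxSum_le (H := ℂ) (A := fun j => α j • 1) (G := fun j => γ j • 1)
    (B := fun i j k => β i j k • 1) (a := a) (b := b) (c := c) ha hc hb ?_
    (boundedColumn_smul_one hγ) ?_ N 1 1
  · have h2 : ∀ j : Fin (n + 1) → ℕ, (List.ofFn fun i : Fin n =>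
        (β i (j i.castSucc) (j i.succ) • (1 : ℂ →L[ℂ] ℂ)) * 1).prod =
        (∏ i : Fin n, β i (j i.castSucc) (j i.succ)) • (1 : ℂ →L[ℂ] ℂ) := by
      intro j
      have h3 := List.prod_ofFn (f := fun i : Fin n => β i (j i.castSucc) (j i.succ))
      rw [← h3]
      have h4 := map_list_prod (algebraMap ℂ (ℂ →L[ℂ] ℂ))
        (List.ofFn fun i : Fin n => β i (j i.castSucc) (j i.succ))
      rw [List.map_ofFn, Algebra.algebraMap_eq_smul_one] at h4
      rw [h4]
      congr 2
    simp only [boxSum, h2] at h1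
    simpa [sum_apply, mul_assoc, mul_comm, mul_left_comm] using h1
  · have h2 := boundedColumn_smul_one (a := fun j => starRingEnd ℂ (α j)) (c := a)
      (by simpa using hα)
    have h3 : (fun j => ContinuousLinearMap.adjoint (α j • (1 : ℂ →L[ℂ] ℂ))) =
        fun j => starRingEnd ℂ (α j) • (1 : ℂ →L[ℂ] ℂ) := by
      funext j
      rw [map_smulₛₗ]
      congr 1
      exact ContinuousLinearMap.adjoint_id
    rw [h3]
    exact h2
  · intro i s t y
    simpa using hβ i s t y

end ScalarBounds

/-! ### From essential suprema to bounds for columns and matrices of spectral integrals. -/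

namespace SpectralMeasure

variable {X : Type u} [MeasurableSpace X] {H : Type v} [NormedAddCommGroup H]
  [InnerProductSpace ℂ H] [CompleteSpace H] {E : SpectralMeasure X H}

theorem eventually_le_essSup (f : X → ℝ≥0∞) : ∀ᶠ x in E.ae, f x ≤ E.essSup f :=
  eventually_le_limsup

theorem eventually_sum_norm_sq_le {f : ℕ → X → ℂ}
    (h : E.essSup (fun x => seqENorm fun j => f j x) < ∞) :
    ∀ᶠ x in E.ae, ∀ s : Finset ℕ, ∑ j ∈ s, ‖f j x‖ ^ 2 ≤
      (E.essSup fun x => seqENorm fun j => f j x).toReal ^ 2 := by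
  filter_upwards [E.eventually_le_essSup fun x => seqENorm fun j => f j x] with x hx
  exact sum_norm_sq_le_of_seqENorm_le h.ne hx

theorem eventually_sum_norm_sq_sum_le {f : ℕ → ℕ → X → ℂ}
    (h : E.essSup (fun x => matrixENorm fun j k => f j k x) < ∞) :
    ∀ᶠ x in E.ae, ∀ (s t : Finset ℕ) (y : ℕ → ℂ),
      ∑ j ∈ s, ‖∑ k ∈ t, f j k x * y k‖ ^ 2 ≤
        (E.essSup fun x => matrixENorm fun j k => f j k x).toReal ^ 2 * ∑ k ∈ t, ‖y k‖ ^ 2 := by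
  filter_upwards [E.eventually_le_essSup fun x => matrixENorm fun j k => f j k x] with x hx
  exact sum_norm_sq_le_of_matrixENorm_le h.ne hx

theorem essBounded_of_seqENorm {f : ℕ → X → ℂ} (hf : ∀ j, Measurable (f j))
    (h : E.essSup (fun x => seqENorm fun j => f j x) < ∞) (j : ℕ) : E.EssBounded (f j) := by
  refine ⟨hf j, (E.essSup fun x => seqENorm fun j => f j x).toReal,
    (eventually_sum_norm_sq_le h).mono fun x hx => ?_⟩
  have h1 := hx {j}
  rw [Finset.sum_singleton] at h1
  exact le_of_sq_le_sq h1 ENNReal.toReal_nonneg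

theorem essBounded_of_matrixENorm {f : ℕ → ℕ → X → ℂ} (hf : ∀ j k, Measurable (f j k))
    (h : E.essSup (fun x => matrixENorm fun j k => f j k x) < ∞) (j k : ℕ) :
    E.EssBounded (f j k) := by
  refine ⟨hf j k, (E.essSup fun x => matrixENorm fun j k => f j k x).toReal,
    (eventually_sum_norm_sq_sum_le h).mono fun x hx => ?_⟩
  have h1 := hx {j} {k} 1
  simp only [Finset.sum_singleton, Pi.one_apply, mul_one, norm_one, one_pow] at h1
  exact le_of_sq_le_sq h1 ENNReal.toReal_nonneg

theorem boundedColumn_integral {f : ℕ → X → ℂ} (hf : ∀ j, Measurable (f j))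
    (h : E.essSup (fun x => seqENorm fun j => f j x) < ∞) :
    BoundedColumn (E.essSup fun x => seqENorm fun j => f j x).toReal
      fun j => E.integral (f j) := by
  intro s x
  have hb := essBounded_of_seqENorm hf h
  simp_rw [fun j => (hb j).isIntegral.norm_sq_apply (hb j)]
  exact sum_integral_norm_sq_le hb (eventually_sum_norm_sq_le h) x s

/-- Spectral integrals are normal: `‖A* h‖ = ‖A h‖`. The adjoint family therefore obeys the same
bound, although for general operators a bounded column gives only a bounded row of adjoints. The
Schatten estimate needs both bounds. -/
theorem boundedColumn_adjoint_integral {f : ℕ → X → ℂ} (hf : ∀ j, Measurable (f j))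
    (h : E.essSup (fun x => seqENorm fun j => f j x) < ∞) :
    BoundedColumn (E.essSup fun x => seqENorm fun j => f j x).toReal
      fun j => ContinuousLinearMap.adjoint (E.integral (f j)) := by
  intro s x
  have hb := essBounded_of_seqENorm hf h
  simp_rw [fun j => (hb j).isIntegral.norm_sq_adjoint_apply (hb j)]
  exact sum_integral_norm_sq_le hb (eventually_sum_norm_sq_le h) x s

theorem boundedMatrix_integral {f : ℕ → ℕ → X → ℂ} (hf : ∀ j k, Measurable (f j k))
    (h : E.essSup (fun x => matrixENorm fun j k => f j k x) < ∞) :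
    BoundedMatrix (E.essSup fun x => matrixENorm fun j k => f j k x).toReal
      fun j k => E.integral (f j k) := by
  classical
  intro s t y
  have hb := essBounded_of_matrixENorm hf h
  have h1 := sum_norm_sq_sum_apply_le (E := E) (ι := s) (κ := t)
    (f := fun j k => f j k) (fun j k => hf j k)
    (b := (E.essSup fun x => matrixENorm fun j k => f j k x).toReal) ?_
    (B := fun j k => E.integral (f j k)) (fun j k => (hb j k).isIntegral) (fun k => y k)
  · have h2 : ∀ j, ∑ k ∈ t, E.integral (f j k) (y k) =
        ∑ k : t, E.integral (f j k) (y k) := fun j =>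
      (Finset.sum_coe_sort t fun k => E.integral (f j k) (y k)).symm
    rw [← Finset.sum_coe_sort s, ← Finset.sum_coe_sort t]
    simp_rw [h2]
    exact h1
  · filter_upwards [eventually_sum_norm_sq_sum_le h] with x hx
    intro c
    have h3 := hx s t fun k => if hk : k ∈ t then c ⟨k, hk⟩ else 0
    rw [← Finset.sum_coe_sort s, ← Finset.sum_coe_sort t] at h3
    simp_rw [← Finset.sum_coe_sort t (fun k => f _ k x * _)] at h3
    simpa using h3

end SpectralMeasure

/-! ### Bounded strong convergence and reduction to rank one operators. -/

section Strong

variable {H : Type v} [NormedAddCommGroup H] [InnerProductSpace ℂ H]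

/-- Ampliation is continuous for bounded strong convergence. -/
theorem tendsto_amp_apply {ι : Type*} {l : Filter ι} {F : ι → H →L[ℂ] H} {T : H →L[ℂ] H} {C : ℝ}
    (hC : ∀ N, ‖F N‖ ≤ C) (hF : ∀ x, Tendsto (fun N => F N x) l (𝓝 (T x))) (x : SeqSpace H) :
    Tendsto (fun N => amp (F N) x) l (𝓝 (amp T x)) := by
  have h1 : Tendsto (fun N => ∑' j, ‖F N (x j) - T (x j)‖ ^ 2) l (𝓝 (∑' _ : ℕ, (0 : ℝ))) := by
    refine tendsto_tsum_of_dominated_convergence (bound := fun j => (C + ‖T‖) ^ 2 * ‖x j‖ ^ 2)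
      ((SeqSpace.hasSum_norm_sq x).summable.mul_left _) (fun j => ?_)
      (Eventually.of_forall fun N j => ?_)
    · simpa using ((hF (x j)).sub_const (T (x j))).norm.pow 2
    · rw [Real.norm_of_nonneg (by positivity), ← mul_pow]
      refine pow_le_pow_left₀ (norm_nonneg _) ((norm_sub_le _ _).trans ?_) 2
      rw [add_mul]
      exact add_le_add ((F N).le_of_opNorm_le (hC N) _) (T.le_opNorm _)
  rw [tsum_zero] at h1
  have h2 := h1.sqrt
  rw [Real.sqrt_zero] at h2
  rw [tendsto_iff_norm_sub_tendsto_zero]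
  refine h2.congr fun N => ?_
  have h3 := (SeqSpace.hasSum_norm_sq (amp (F N) x - amp T x)).tsum_eq
  simp only [lp.coeFn_sub, Pi.sub_apply, amp_apply] at h3
  rw [h3, Real.sqrt_sq (norm_nonneg _)]

/-- The rank one operator `x ↦ ⟨w, x⟩ u`. -/
abbrev rankOne (u w : H) : H →L[ℂ] H := InnerProductSpace.rankOne ℂ u w

theorem rankOne_chain_apply {n : ℕ} (u w : Fin (n + 1) → H) (B : Fin n → H →L[ℂ] H) (y : H) :
    rankOne (u 0) (w 0) ((List.ofFn fun i : Fin n =>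
      B i * rankOne (u i.succ) (w i.succ)).prod y) =
      ((∏ i : Fin n, inner ℂ (w i.castSucc) (B i (u i.succ))) * inner ℂ (w (Fin.last n)) y) •
        u 0 := by
  induction n with
  | zero => simp
  | succ n ih =>
    rw [List.ofFn_succ, List.prod_cons, mul_apply_eq_comp, mul_apply_eq_comp]
    have h1 := ih (fun i => u i.succ) (fun i => w i.succ) (fun i => B i.succ)
    rw [h1, Fin.prod_univ_succ, InnerProductSpace.rankOne_apply, map_smul, inner_smul_right]
    congr 1
    simp only [Fin.castSucc_zero, Fin.succ_last, Fin.castSucc_succ]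
    ring

variable [CompleteSpace H]

/-- Finite rank operators are in general not norm dense among bounded ones; continuity for bounded
strong convergence is what allows the approximation of arbitrary `T`. -/
theorem tendsto_inner_chainOp {n : ℕ} {V W : H →L[ℂ] SeqSpace H}
    {Bop : Fin n → SeqSpace H →L[ℂ] SeqSpace H} {ι : Type*} {l : Filter ι}
    {F : ι → Fin (n + 1) → H →L[ℂ] H} {T : Fin (n + 1) → H →L[ℂ] H} {C : Fin (n + 1) → ℝ}
    (hC : ∀ N i, ‖F N i‖ ≤ C i) (hF : ∀ i x, Tendsto (fun N => F N i x) l (𝓝 (T i x))) (g h : H) :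
    Tendsto (fun N => inner ℂ g (chainOp V W Bop (F N) h)) l
      (𝓝 (inner ℂ g (chainOp V W Bop T h))) := by
  simp_rw [inner_chainOp]
  refine tendsto_const_nhds.inner ?_
  refine tendsto_clm_apply (fun N => (norm_amp_le _).trans (hC N 0))
    (tendsto_amp_apply (fun N => hC N 0) (hF 0)) ?_
  refine tendsto_ofFn_prod_apply (C := fun i => ‖Bop i‖ * C i.succ) ?_ ?_ _
  · intro N i
    exact (norm_mul_le _ _).trans (mul_le_mul_of_nonneg_left
      ((norm_amp_le _).trans (hC N i.succ)) (norm_nonneg _))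
  · intro i x
    exact ((Bop i).continuous.tendsto _).comp
      (tendsto_amp_apply (fun N => hC N i.succ) (hF i.succ) x)

/-- The matrix coefficient of `chainOp` as a multilinear map of the operators `T`. -/
def chainMultilinear {n : ℕ} (V W : H →L[ℂ] SeqSpace H)
    (Bop : Fin n → SeqSpace H →L[ℂ] SeqSpace H) (g h : H) :
    MultilinearMap ℂ (fun _ : Fin (n + 1) => H →L[ℂ] H) ℂ :=
  ((innerSL ℂ (V g) : SeqSpace H →ₗ[ℂ] ℂ) ∘ₗ
      (ContinuousLinearMap.apply ℂ (SeqSpace H) (W h) :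
        (SeqSpace H →L[ℂ] SeqSpace H) →ₗ[ℂ] SeqSpace H)).compMultilinearMap
    ((MultilinearMap.mkPiAlgebraFin ℂ (n + 1) (SeqSpace H →L[ℂ] SeqSpace H)).compLinearMap
      -- There is one more `T` than there are matrices; the leading `1` is paired with `T 0`.
      fun i => LinearMap.mulLeft ℂ ((Fin.cons 1 Bop : Fin (n + 1) → _) i) ∘ₗ ampLinear)

theorem chainMultilinear_apply {n : ℕ} (V W : H →L[ℂ] SeqSpace H)
    (Bop : Fin n → SeqSpace H →L[ℂ] SeqSpace H) (g h : H) (T : Fin (n + 1) → H →L[ℂ] H) :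
    chainMultilinear V W Bop g h T = inner ℂ g (chainOp V W Bop T h) := by
  rw [inner_chainOp, chainMultilinear, LinearMap.compMultilinearMap_apply,
    MultilinearMap.compLinearMap_apply, MultilinearMap.mkPiAlgebraFin_apply, List.ofFn_succ,
    List.prod_cons]
  simp [ampLinear]

/-- Two chains that agree on rank one operators agree. -/
theorem inner_chainOp_congr {n : ℕ} {V W V' W' : H →L[ℂ] SeqSpace H}
    {Bop Bop' : Fin n → SeqSpace H →L[ℂ] SeqSpace H} {g h : H}
    (hr : ∀ u w : Fin (n + 1) → H, inner ℂ g (chainOp V W Bop (fun i => rankOne (u i) (w i)) h) =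
      inner ℂ g (chainOp V' W' Bop' (fun i => rankOne (u i) (w i)) h))
    (T : Fin (n + 1) → H →L[ℂ] H) :
    inner ℂ g (chainOp V W Bop T h) = inner ℂ g (chainOp V' W' Bop' T h) := by
  classical
  obtain ⟨ι, e, -⟩ := exists_hilbertBasis ℂ H
  -- This is `P_s T i`, with `P_s` the projection onto finitely many basis vectors: a finite sum of
  -- rank one operators, of norm at most `‖T i‖`, converging strongly to `T i`.
  set F : Finset ι → Fin (n + 1) → H →L[ℂ] H := fun s i =>
    ∑ a ∈ s, rankOne (e a) (ContinuousLinearMap.adjoint (T i) (e a)) with hF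
  have hFa : ∀ s i x, F s i x = ∑ a ∈ s, inner ℂ (e a) (T i x) • e a := by
    intro s i x
    simp only [hF, sum_apply, InnerProductSpace.rankOne_apply,
      ContinuousLinearMap.adjoint_inner_left]
  have hC : ∀ s i, ‖F s i‖ ≤ ‖T i‖ := by
    intro s i
    refine ContinuousLinearMap.opNorm_le_bound _ (norm_nonneg _) fun x => ?_
    refine le_trans ?_ ((T i).le_opNorm x)
    rw [hFa]
    refine le_of_sq_le_sq ?_ (norm_nonneg _)
    have h1 := e.orthonormal.sum_inner_products_le (T i x) (s := s)
    have h2 := e.orthonormal.inner_sum (fun a => inner ℂ (e a) (T i x))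
      (fun a => inner ℂ (e a) (T i x)) s
    rw [inner_self_eq_norm_sq_to_K] at h2
    refine le_trans (le_of_eq ?_) h1
    simp only [RCLike.conj_mul] at h2
    exact_mod_cast h2
  have hlim : ∀ i x, Tendsto (fun s => F s i x) atTop (𝓝 (T i x)) := by
    intro i x
    simp_rw [hFa]
    have := e.hasSum_repr (T i x)
    simp only [HilbertBasis.repr_apply_apply] at this
    exact this
  refine tendsto_nhds_unique (tendsto_inner_chainOp hC hlim g h) ?_
  refine (tendsto_inner_chainOp (V := V') (W := W') (Bop := Bop') hC hlim g h).congr fun s => ?_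
  rw [← chainMultilinear_apply, ← chainMultilinear_apply, hF]
  simp only [MultilinearMap.map_sum_finset]
  refine Finset.sum_congr rfl fun r _ => ?_
  rw [chainMultilinear_apply, chainMultilinear_apply]
  exact (hr _ _).symm

/-- The coefficients and vectors are chosen before `A`, so the same ones serve all terms of all
representations. -/
theorem exists_polarization (y x : H) : ∃ (c : Fin 4 → ℂ) (v : Fin 4 → H),
    ∀ A : H →L[ℂ] H, inner ℂ y (A x) = ∑ k, c k * inner ℂ (v k) (A (v k)) := by
  refine ⟨![1 / 4, -1 / 4, Complex.I / 4, -Complex.I / 4],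
    ![x + y, x - y, x + Complex.I • y, x - Complex.I • y], fun A => ?_⟩
  have h := inner_map_polarization
    (ContinuousLinearMap.adjoint A : H →ₗ[ℂ] H) x y
  simp only [ContinuousLinearMap.coe_coe, ContinuousLinearMap.adjoint_inner_left] at h
  rw [h, Fin.sum_univ_four]
  simp only [Matrix.cons_val]
  ring

end Strong

/-! ### Existence of the multiple operator integral and independence of the representation. -/

namespace HaagerupRep

variable {H : Type v} [NormedAddCommGroup H] [InnerProductSpace ℂ H] [CompleteSpace H]
  {n : ℕ} {X : Fin (n + 2) → Type u} [∀ i, MeasurableSpace (X i)]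
  {E : ∀ i, SpectralMeasure (X i) H} {Ψ : (∀ i, X i) → ℂ}

/-- The factors of the term with index `j` of the representation. -/
def factor (R : HaagerupRep E Ψ) (j : Fin (n + 1) → ℕ) : ∀ i : Fin (n + 2), X i → ℂ :=
  Fin.lastCases (R.γ (j (Fin.last n))) fun i' =>
    Fin.cases (motive := fun i' : Fin (n + 1) => X i'.castSucc → ℂ) (R.α (j 0))
      (fun i => R.β i (j i.castSucc) (j i.succ)) i'

theorem factor_zero (R : HaagerupRep E Ψ) (j : Fin (n + 1) → ℕ) :
    R.factor j 0 = R.α (j 0) :=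
  Fin.lastCases_castSucc (motive := fun i => X i → ℂ) (0 : Fin (n + 1))

theorem factor_last (R : HaagerupRep E Ψ) (j : Fin (n + 1) → ℕ) :
    R.factor j (Fin.last (n + 1)) = R.γ (j (Fin.last n)) :=
  Fin.lastCases_last (motive := fun i => X i → ℂ)

theorem factor_mid (R : HaagerupRep E Ψ) (j : Fin (n + 1) → ℕ) (i : Fin n) :
    R.factor j i.succ.castSucc = R.β i (j i.castSucc) (j i.succ) :=
  Fin.lastCases_castSucc (motive := fun i => X i → ℂ) i.succ

theorem prod_fin_ends {M : Type*} [CommMonoid M] (f : Fin (n + 2) → M) :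
    ∏ i, f i = f 0 * (∏ i : Fin n, f i.succ.castSucc) * f (Fin.last (n + 1)) := by
  rw [Fin.prod_univ_castSucc, Fin.prod_univ_succ]
  rfl

theorem essBounded_factor (R : HaagerupRep E Ψ) (j : Fin (n + 1) → ℕ) (i : Fin (n + 2)) :
    (E i).EssBounded (R.factor j i) := by
  refine Fin.lastCases ?_ (fun i' => Fin.cases ?_ (fun i => ?_) i') i
  · rw [factor_last]
    exact SpectralMeasure.essBounded_of_seqENorm R.measurable_γ R.bounded_γ _
  · have := SpectralMeasure.essBounded_of_seqENorm R.measurable_α R.bounded_α (j 0)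
    rw [← factor_zero] at this
    exact this
  · rw [factor_mid]
    exact SpectralMeasure.essBounded_of_matrixENorm (R.measurable_β i) (R.bounded_β i) _ _

theorem opPartialSum_eq_boxSum (R : HaagerupRep E Ψ) (T : Fin (n + 1) → H →L[ℂ] H)
    (N : Fin (n + 1) → ℕ) :
    R.opPartialSum T N = boxSum (fun j => (E 0).integral (R.α j))
      (fun i j k => (E i.succ.castSucc).integral (R.β i j k))
      (fun j => (E (Fin.last (n + 1))).integral (R.γ j)) T N := rfl

/-- The `i`-th spectral integral stands between the functional of the rank one operator on its left
and the vector of the one on its right. Hence the shift: `g` is put before `w` and `h` after `u`. -/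
theorem inner_opTerm_rankOne (R : HaagerupRep E Ψ) (u w : Fin (n + 1) → H)
    (j : Fin (n + 1) → ℕ) (g h : H) :
    inner ℂ g (R.opTerm (fun i => rankOne (u i) (w i)) j h) =
      ∏ i : Fin (n + 2), inner ℂ ((Fin.cons g w : Fin (n + 2) → H) i)
        ((E i).integral (R.factor j i) ((Fin.snoc u h : Fin (n + 2) → H) i)) := by
  rw [prod_fin_ends]
  simp only [factor_zero, factor_last, factor_mid, opTerm, mul_apply_eq_comp]
  rw [rankOne_chain_apply, map_smul, inner_smul_right]
  have h1 : (Fin.snoc u h : Fin (n + 2) → H) 0 = u 0 :=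
    Fin.snoc_castSucc (α := fun _ => H) h u 0
  have h2 : (Fin.cons g w : Fin (n + 2) → H) (Fin.last (n + 1)) = w (Fin.last n) := rfl
  have h3 : ∀ i : Fin n, (Fin.cons g w : Fin (n + 2) → H) i.succ.castSucc = w i.castSucc :=
    fun i => rfl
  have h4 : ∀ i : Fin n, (Fin.snoc u h : Fin (n + 2) → H) i.succ.castSucc = u i.succ :=
    fun i => Fin.snoc_castSucc (α := fun _ => H) h u i.succ
  simp only [h1, h2, h3, h4, Fin.snoc_last, Fin.cons_zero]
  ring

/-- The terms of the representation, integrated against a product of scalar measures. -/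
theorem tendsto_sum_prod_inner (R : HaagerupRep E Ψ) (v : Fin (n + 2) → H) :
    Tendsto (fun N : Fin (n + 1) → ℕ => ∑ j ∈ Fintype.piFinset fun i => Finset.range (N i),
      ∏ i, inner ℂ (v i) ((E i).integral (R.factor j i) (v i))) atTop
      (𝓝 (∫ x, Ψ x ∂(Measure.pi fun i => (E i).scalarMeasure (v i)))) := by
  set μ := Measure.pi fun i => (E i).scalarMeasure (v i) with hμ
  have h1 : ∀ N : Fin (n + 1) → ℕ, ∑ j ∈ Fintype.piFinset fun i => Finset.range (N i),
      ∏ i, inner ℂ (v i) ((E i).integral (R.factor j i) (v i)) =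
      ∫ x, ∑ j ∈ Fintype.piFinset fun i => Finset.range (N i), ∏ i, R.factor j i (x i) ∂μ := by
    intro N
    rw [integral_finsetSum]
    · refine Finset.sum_congr rfl fun j _ => ?_
      rw [hμ, integral_fintype_prod_eq_prod]
      exact Finset.prod_congr rfl fun i _ => (R.essBounded_factor j i).isIntegral (v i)
    · intro j _
      exact Integrable.fintype_prod_dep fun i => (R.essBounded_factor j i).integrable (v i)
  simp_rw [h1]
  have heval : ∀ (i : Fin (n + 2)) {p : X i → Prop}, (∀ᶠ y in (E i).ae, p y) →
      ∀ᵐ x ∂μ, p (x i) := fun i p hp =>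
    (Measure.tendsto_eval_ae_ae (μ := fun i => (E i).scalarMeasure (v i)) (i := i)).eventually
      (SpectralMeasure.ae_le_ae (v i) hp)
  -- The dominating function is the size of the representation, a constant independent of the box;
  -- it is integrable because the product measure is finite.
  refine tendsto_integral_filter_of_dominated_convergence
    (fun _ => ((E 0).essSup fun x => seqENorm fun j => R.α j x).toReal *
      (∏ i : Fin n, ((E i.succ.castSucc).essSup
        fun x => matrixENorm fun j k => R.β i j k x).toReal) *
      ((E (Fin.last (n + 1))).essSup fun x => seqENorm fun j => R.γ j x).toReal)
    (Eventually.of_forall fun N => ?_) (Eventually.of_forall fun N => ?_) (integrable_const _) ?_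
  · refine Measurable.aestronglyMeasurable (Finset.measurable_sum _ fun j _ => ?_)
    exact Finset.measurable_prod _ fun i _ =>
      (R.essBounded_factor j i).1.comp (measurable_pi_apply i)
  · have hβ := ae_all_iff.2 fun i : Fin n =>
      heval i.succ.castSucc (SpectralMeasure.eventually_sum_norm_sq_sum_le (R.bounded_β i))
    filter_upwards [heval 0 (SpectralMeasure.eventually_sum_norm_sq_le R.bounded_α),
      heval (Fin.last (n + 1)) (SpectralMeasure.eventually_sum_norm_sq_le R.bounded_γ),
      hβ] with x h2 h3 h4
    simp_rw [prod_fin_ends, factor_zero, factor_last, factor_mid]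
    exact norm_sum_piFinset_le ENNReal.toReal_nonneg ENNReal.toReal_nonneg
      (fun _ => ENNReal.toReal_nonneg) h2 h3 h4 N
  · have h2 : ∀ᵐ x ∂μ, _ := (le_iSup (fun h : Fin (n + 2) → H =>
      MeasureTheory.ae (Measure.pi fun i => (E i).scalarMeasure (h i))) v) R.tendsto_sum
    filter_upwards [h2] with x hx
    simp_rw [prod_fin_ends, factor_zero, factor_last, factor_mid]
    exact hx

/-- For rank one operators the limit of the box sums depends on `Ψ` only. -/
theorem exists_tendsto_rankOne (E : ∀ i, SpectralMeasure (X i) H) (Ψ : (∀ i, X i) → ℂ)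
    (u w : Fin (n + 1) → H) (g h : H) :
    ∃ z : ℂ, ∀ R : HaagerupRep E Ψ, Tendsto (fun N : Fin (n + 1) → ℕ =>
      inner ℂ g (R.opPartialSum (fun i => rankOne (u i) (w i)) N h)) atTop (𝓝 z) := by
  classical
  choose c v hcv using fun i : Fin (n + 2) => exists_polarization
    ((Fin.cons g w : Fin (n + 2) → H) i) ((Fin.snoc u h : Fin (n + 2) → H) i)
  -- Polarization in each of the `n + 2` slots gives a combination of integrals of `Ψ` in which no
  -- representation occurs.
  refine ⟨∑ k ∈ Fintype.piFinset fun _ : Fin (n + 2) => (Finset.univ : Finset (Fin 4)),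
    (∏ i, c i (k i)) * ∫ x, Ψ x ∂(Measure.pi fun i => (E i).scalarMeasure (v i (k i))),
    fun R => ?_⟩
  have h1 : Tendsto (fun N : Fin (n + 1) → ℕ =>
      ∑ k ∈ Fintype.piFinset fun _ : Fin (n + 2) => (Finset.univ : Finset (Fin 4)),
        (∏ i, c i (k i)) * ∑ j ∈ Fintype.piFinset fun i => Finset.range (N i),
          ∏ i, inner ℂ (v i (k i)) ((E i).integral (R.factor j i) (v i (k i)))) atTop _ :=
    tendsto_finsetSum _ fun k _ => (R.tendsto_sum_prod_inner fun i => v i (k i)).const_mul _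
  refine h1.congr fun N => ?_
  rw [opPartialSum, sum_apply, inner_sum]
  simp_rw [inner_opTerm_rankOne, hcv, Finset.prod_univ_sum, Finset.prod_mul_distrib,
    Finset.mul_sum]
  rw [Finset.sum_comm]

theorem exists_chain (R : HaagerupRep E Ψ) :
    ∃ (V W : H →L[ℂ] SeqSpace H) (Bop : Fin n → SeqSpace H →L[ℂ] SeqSpace H),
      (∀ x j, V x j = ContinuousLinearMap.adjoint ((E 0).integral (R.α j)) x) ∧
      (∀ x j, W x j = (E (Fin.last (n + 1))).integral (R.γ j) x) ∧
      (∀ T g h, Tendsto (fun N => inner ℂ g (R.opPartialSum T N h)) atTop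
        (𝓝 (inner ℂ g (chainOp V W Bop T h)))) ∧
      (∀ i, ‖Bop i‖ ≤ ((E i.succ.castSucc).essSup
        fun x => matrixENorm fun j k => R.β i j k x).toReal) := by
  obtain ⟨V, -, hV⟩ := (SpectralMeasure.boundedColumn_adjoint_integral R.measurable_α
    R.bounded_α).exists_clm ENNReal.toReal_nonneg
  obtain ⟨W, -, hW⟩ := (SpectralMeasure.boundedColumn_integral R.measurable_γ
    R.bounded_γ).exists_clm ENNReal.toReal_nonneg
  choose Bop hBn hB using fun i => (SpectralMeasure.boundedMatrix_integral (R.measurable_β i)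
    (R.bounded_β i)).exists_clm ENNReal.toReal_nonneg
  refine ⟨V, W, Bop, hV, hW, fun T g h => ?_, hBn⟩
  simp_rw [opPartialSum_eq_boxSum]
  exact tendsto_inner_boxSum hV hW hB T g h

/-- The multiple operator integral exists, for arbitrary bounded operators. -/
theorem exists_isMultipleOperatorIntegral (R : HaagerupRep E Ψ) (T : Fin (n + 1) → H →L[ℂ] H) :
    ∃ J, IsMultipleOperatorIntegral E Ψ T J := by
  obtain ⟨V, W, Bop, -, -, hlim, -⟩ := R.exists_chain
  refine ⟨chainOp V W Bop T, ⟨R⟩, fun R' g h => ?_⟩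
  obtain ⟨V', W', Bop', -, -, hlim', -⟩ := R'.exists_chain
  have h1 : inner ℂ g (chainOp V W Bop T h) = inner ℂ g (chainOp V' W' Bop' T h) := by
    refine inner_chainOp_congr (fun u w => ?_) T
    obtain ⟨z, hz⟩ := exists_tendsto_rankOne E Ψ u w g h
    rw [tendsto_nhds_unique (hlim _ g h) (hz R), tendsto_nhds_unique (hlim' _ g h) (hz R')]
  rw [h1]
  exact hlim' T g h

end HaagerupRep

/-! ### Singular value decomposition of finite rank operators. -/

section FiniteRank

variable {H : Type v} [NormedAddCommGroup H] [InnerProductSpace ℂ H]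

theorem norm_sq_sum_smul_orthonormal {ι : Type*} {v : ι → H} (hv : Orthonormal ℂ v)
    (s : Finset ι) (a : ι → ℂ) : ‖∑ i ∈ s, a i • v i‖ ^ 2 = ∑ i ∈ s, ‖a i‖ ^ 2 := by
  have h2 := hv.inner_sum a a s
  rw [inner_self_eq_norm_sq_to_K] at h2
  simp only [RCLike.conj_mul] at h2
  exact_mod_cast h2

/-- A singular value decomposition with finitely many positive singular values. -/
structure FiniteSVD (F : H →L[ℂ] H) where
  /-- the number of singular values -/
  len : ℕ
  /-- the singular values -/
  σ : Fin len → ℝ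
  /-- the right singular vectors -/
  u : Fin len → H
  /-- the left singular vectors -/
  v : Fin len → H
  antitone : Antitone σ
  pos : ∀ i, 0 < σ i
  orthonormal_u : Orthonormal ℂ u
  orthonormal_v : Orthonormal ℂ v
  apply_eq : ∀ x, F x = ∑ i, ((σ i : ℂ) * inner ℂ (u i) x) • v i

theorem FiniteSVD.apply_u {F : H →L[ℂ] H} (S : FiniteSVD F) (i : Fin S.len) :
    F (S.u i) = (S.σ i : ℂ) • S.v i := by
  rw [S.apply_eq, Finset.sum_eq_single i]
  · simp [inner_self_eq_norm_sq_to_K, S.orthonormal_u.1 i]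
  · intro j _ hj
    rw [S.orthonormal_u.2 hj, mul_zero, zero_smul]
  · simp

theorem FiniteSVD.norm_sq_apply {F : H →L[ℂ] H} (S : FiniteSVD F) (x : H) :
    ‖F x‖ ^ 2 = ∑ i, S.σ i ^ 2 * ‖inner ℂ (S.u i) x‖ ^ 2 := by
  rw [S.apply_eq, norm_sq_sum_smul_orthonormal S.orthonormal_v]
  refine Finset.sum_congr rfl fun i _ => ?_
  rw [norm_mul, mul_pow, Complex.norm_real, Real.norm_eq_abs, sq_abs]

/-- The `k`-th approximation number is at most any bound for the singular values from the `k`-th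
on. -/
theorem FiniteSVD.singularValue_le {F : H →L[ℂ] H} (S : FiniteSVD F) {k : ℕ} {c : ℝ} (hc : 0 ≤ c)
    (h : ∀ i : Fin S.len, k ≤ i → S.σ i ≤ c) : singularValue F k ≤ ENNReal.ofReal c := by
  classical
  set s : Finset (Fin S.len) := Finset.univ.filter fun i => (i : ℕ) < k with hs
  -- The competitor in the infimum is the decomposition cut after its first `k` terms.
  set G : H →L[ℂ] H := ∑ i ∈ s, rankOne ((S.σ i : ℂ) • S.v i) (S.u i) with hG
  have hGa : ∀ x, G x = ∑ i ∈ s, ((S.σ i : ℂ) * inner ℂ (S.u i) x) • S.v i := by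
    intro x
    simp only [hG, sum_apply, InnerProductSpace.rankOne_apply, smul_smul]
    exact Finset.sum_congr rfl fun i _ => by rw [mul_comm]
  have hrank : (G : H →ₗ[ℂ] H).rank ≤ k := by
    have h1 : LinearMap.range (G : H →ₗ[ℂ] H) ≤
        Submodule.span ℂ ((s.image S.v : Finset H) : Set H) := by
      rintro _ ⟨x, rfl⟩
      rw [ContinuousLinearMap.coe_coe, hGa]
      refine Submodule.sum_mem _ fun i hi => Submodule.smul_mem _ _ (Submodule.subset_span ?_)
      exact Finset.mem_coe.2 (Finset.mem_image_of_mem _ hi)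
    refine (Submodule.rank_mono h1).trans ((rank_span_finset_le _).trans ?_)
    have h2 : (s.image S.v).card ≤ k := by
      refine Finset.card_image_le.trans ?_
      have h3 : s.card ≤ (Finset.range k).card := by
        refine Finset.card_le_card_of_injOn (fun i => (i : ℕ)) (fun i hi => ?_)
          (fun i _ j _ hij => Fin.ext hij)
        simpa [hs] using hi
      simpa using h3
    exact_mod_cast h2
  refine (iInf₂_le G hrank).trans ?_
  rw [← ofReal_norm]
  refine ENNReal.ofReal_le_ofReal (ContinuousLinearMap.opNorm_le_bound _ hc fun x => ?_)
  refine le_of_sq_le_sq ?_ (by positivity)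
  have h1 : (F - G) x = ∑ i ∈ Finset.univ \ s, ((S.σ i : ℂ) * inner ℂ (S.u i) x) • S.v i := by
    rw [sub_apply, S.apply_eq, hGa, sub_eq_iff_eq_add,
      Finset.sum_sdiff (Finset.subset_univ s)]
  rw [h1, norm_sq_sum_smul_orthonormal S.orthonormal_v, mul_pow]
  calc _ ≤ ∑ i ∈ Finset.univ \ s, c ^ 2 * ‖inner ℂ (S.u i) x‖ ^ 2 := by
        refine Finset.sum_le_sum fun i hi => ?_
        have h2 : k ≤ i := by simpa [hs] using hi
        rw [norm_mul, mul_pow, Complex.norm_real, Real.norm_eq_abs, abs_of_pos (S.pos i)]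
        exact mul_le_mul_of_nonneg_right (pow_le_pow_left₀ (S.pos i).le (h i h2) 2) (by positivity)
    _ ≤ c ^ 2 * ‖x‖ ^ 2 := by
        rw [← Finset.mul_sum]
        exact mul_le_mul_of_nonneg_left (S.orthonormal_u.sum_inner_products_le x) (by positivity)

/-- Dimension count: an operator `G` of rank at most `l` kills some `x ≠ 0` in the span of the first
`l + 1` right singular vectors, and there `‖(F - G) x‖ = ‖F x‖ ≥ σ_l ‖x‖`. -/
theorem FiniteSVD.le_singularValue {F : H →L[ℂ] H} (S : FiniteSVD F) (l : Fin S.len) :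
    ENNReal.ofReal (S.σ l) ≤ singularValue F l := by
  refine le_iInf₂ fun G hG => ?_
  have hfin : FiniteDimensional ℂ (LinearMap.range (G : H →ₗ[ℂ] H)) :=
    Module.rank_lt_aleph0_iff.1 (hG.trans_lt (Cardinal.natCast_lt_aleph0))
  have hfr : Module.finrank ℂ (LinearMap.range (G : H →ₗ[ℂ] H)) ≤ l :=
    Module.finrank_le_of_rank_le hG
  let ι : Fin (l + 1) → Fin S.len := Fin.castLE l.2
  have hι : Function.Injective ι := Fin.castLE_injective _
  let L : (Fin (l + 1) → ℂ) →ₗ[ℂ] LinearMap.range (G : H →ₗ[ℂ] H) :=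
    (G : H →ₗ[ℂ] H).rangeRestrict ∘ₗ Fintype.linearCombination ℂ (fun i => S.u (ι i))
  have hker : LinearMap.ker L ≠ ⊥ :=
    LinearMap.ker_ne_bot_of_finrank_lt (by rw [Module.finrank_fin_fun]; omega)
  obtain ⟨c, hc, hc0⟩ := Submodule.exists_mem_ne_zero_of_ne_bot hker
  set x : H := ∑ i, c i • S.u (ι i) with hx
  have hGx : G x = 0 := by
    have := congrArg Subtype.val (LinearMap.mem_ker.1 hc)
    rw [hx, map_sum]
    simpa [L, Fintype.linearCombination_apply] using this
  have hxn : ‖x‖ ^ 2 = ∑ i, ‖c i‖ ^ 2 :=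
    norm_sq_sum_smul_orthonormal (S.orthonormal_u.comp ι hι) _ _
  have hFx : ‖F x‖ ^ 2 = ∑ i, S.σ (ι i) ^ 2 * ‖c i‖ ^ 2 := by
    have h1 : F x = ∑ i, (c i * (S.σ (ι i) : ℂ)) • S.v (ι i) := by
      rw [hx, map_sum]
      exact Finset.sum_congr rfl fun i _ => by rw [map_smul, S.apply_u, smul_smul]
    rw [h1]
    refine (norm_sq_sum_smul_orthonormal (S.orthonormal_v.comp ι hι) _ _).trans ?_
    refine Finset.sum_congr rfl fun i _ => ?_
    rw [norm_mul, mul_pow, Complex.norm_real, Real.norm_eq_abs, sq_abs, mul_comm]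
  have hx0 : 0 < ‖x‖ := by
    obtain ⟨i, hi⟩ := Function.ne_iff.1 hc0
    have h1 : 0 < ‖x‖ ^ 2 := by
      rw [hxn]
      exact Finset.sum_pos' (fun _ _ => by positivity)
        ⟨i, Finset.mem_univ i, by have := norm_pos_iff.2 hi; positivity⟩
    exact lt_of_pow_lt_pow_left₀ 2 (norm_nonneg _) (by simpa using h1)
  have h1 : S.σ l * ‖x‖ ≤ ‖F x‖ := by
    refine le_of_sq_le_sq ?_ (norm_nonneg _)
    rw [mul_pow, hxn, hFx, Finset.mul_sum]
    refine Finset.sum_le_sum fun i _ => mul_le_mul_of_nonneg_right ?_ (by positivity)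
    refine pow_le_pow_left₀ (S.pos l).le (S.antitone ?_) 2
    exact Fin.le_def.2 (Nat.lt_succ_iff.1 i.2)
  have h2 : ‖F x‖ ≤ ‖F - G‖ * ‖x‖ := by
    have := (F - G).le_opNorm x
    rwa [sub_apply, hGx, sub_zero] at this
  rw [← ofReal_norm]
  exact ENNReal.ofReal_le_ofReal (le_of_mul_le_mul_right (h1.trans h2) hx0)

/-- Operators of finite rank. -/
def IsFiniteRank (F : H →L[ℂ] H) : Prop := (F : H →ₗ[ℂ] H).rank < Cardinal.aleph0

theorem IsFiniteRank.finiteDimensional {F : H →L[ℂ] H} (hF : IsFiniteRank F) :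
    FiniteDimensional ℂ (LinearMap.range (F : H →ₗ[ℂ] H)) :=
  Module.rank_lt_aleph0_iff.1 hF

theorem isFiniteRank_starProjection (U : Submodule ℂ H) [FiniteDimensional ℂ U] :
    IsFiniteRank U.starProjection := by
  rw [IsFiniteRank, LinearMap.rank, Submodule.range_starProjection]
  exact Module.rank_lt_aleph0 ℂ U

theorem IsFiniteRank.mul_left {F : H →L[ℂ] H} (hF : IsFiniteRank F) (G : H →L[ℂ] H) :
    IsFiniteRank (G * F) :=
  (LinearMap.rank_comp_le_right (F : H →ₗ[ℂ] H) (G : H →ₗ[ℂ] H)).trans_lt hF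

theorem IsFiniteRank.mul_right {F : H →L[ℂ] H} (hF : IsFiniteRank F) (G : H →L[ℂ] H) :
    IsFiniteRank (F * G) :=
  (LinearMap.rank_comp_le_left (G : H →ₗ[ℂ] H) (F : H →ₗ[ℂ] H)).trans_lt hF

theorem IsFiniteRank.add {F G : H →L[ℂ] H} (hF : IsFiniteRank F) (hG : IsFiniteRank G) :
    IsFiniteRank (F + G) :=
  (LinearMap.rank_add_le (F : H →ₗ[ℂ] H) (G : H →ₗ[ℂ] H)).trans_lt (Cardinal.add_lt_aleph0 hF hG)

variable [CompleteSpace H]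

/-- With `P` the projection onto the range of `F`, `F = P F` gives `F* = F* P`, and `P` has the rank
of `F`. -/
theorem rank_adjoint_le {F : H →L[ℂ] H} (hF : IsFiniteRank F) :
    (ContinuousLinearMap.adjoint F : H →ₗ[ℂ] H).rank ≤ (F : H →ₗ[ℂ] H).rank := by
  have := hF.finiteDimensional
  set P := (LinearMap.range (F : H →ₗ[ℂ] H)).starProjection with hP
  have h1 : P * F = F := by
    ext x
    exact Submodule.starProjection_eq_self_iff.2 ⟨x, rfl⟩
  have hPs : ContinuousLinearMap.adjoint P = P :=
    (isStarProjection_starProjection (U := LinearMap.range (F : H →ₗ[ℂ] H))).isSelfAdjoint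
  have h2 : ContinuousLinearMap.adjoint F = ContinuousLinearMap.adjoint F * P := by
    conv_lhs => rw [← h1]
    exact (ContinuousLinearMap.adjoint_comp P F).trans (by rw [hPs]; rfl)
  rw [h2]
  refine (LinearMap.rank_comp_le_right (P : H →ₗ[ℂ] H)
    (ContinuousLinearMap.adjoint F : H →ₗ[ℂ] H)).trans (le_of_eq ?_)
  rw [LinearMap.rank, hP, Submodule.range_starProjection, LinearMap.rank]

theorem IsFiniteRank.adjoint {F : H →L[ℂ] H} (hF : IsFiniteRank F) :
    IsFiniteRank (ContinuousLinearMap.adjoint F) :=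
  (rank_adjoint_le hF).trans_lt hF

theorem singularValue_adjoint_le (T : H →L[ℂ] H) (k : ℕ) :
    singularValue (ContinuousLinearMap.adjoint T) k ≤ singularValue T k := by
  refine le_iInf₂ fun F hF => ?_
  have hF' : IsFiniteRank F := hF.trans_lt Cardinal.natCast_lt_aleph0
  refine (iInf₂_le (ContinuousLinearMap.adjoint F) ((rank_adjoint_le hF').trans hF)).trans
    (le_of_eq ?_)
  rw [← map_sub, ← ofReal_norm, ← ofReal_norm, LinearIsometryEquiv.norm_map]

theorem schattenENorm_adjoint_le (p : ℝ≥0∞) (T : H →L[ℂ] H) :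
    schattenENorm p (ContinuousLinearMap.adjoint T) ≤ schattenENorm p T := by
  rw [schattenENorm, schattenENorm]
  split_ifs
  · rw [← ofReal_norm, ← ofReal_norm, LinearIsometryEquiv.norm_map]
  · gcongr
    exact singularValue_adjoint_le T _

/-- `F* F` is diagonalized on the finite-dimensional invariant space `U = range F*`. Since `U` is
orthogonal to `ker F`, every singular value is positive; since `F` vanishes on the complement of
`U`, nothing is lost. -/
theorem IsFiniteRank.nonempty_finiteSVD {F : H →L[ℂ] H} (hF : IsFiniteRank F) :
    Nonempty (FiniteSVD F) := by
  classical
  set U := LinearMap.range (ContinuousLinearMap.adjoint F : H →ₗ[ℂ] H) with hU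
  have hfin : FiniteDimensional ℂ U := hF.adjoint.finiteDimensional
  set S : H →ₗ[ℂ] H := ((ContinuousLinearMap.adjoint F * F : H →L[ℂ] H) : H →ₗ[ℂ] H)
    with hS
  have hSa : ∀ x, S x = ContinuousLinearMap.adjoint F (F x) := fun x => rfl
  have hsymm : S.IsSymmetric := fun x y => by
    rw [hSa, hSa, ContinuousLinearMap.adjoint_inner_left, ContinuousLinearMap.adjoint_inner_right]
  have hinv : ∀ x ∈ U, S x ∈ U := fun x _ => ⟨F x, rfl⟩
  have hres := hsymm.restrict_invariant hinv
  set b := hres.eigenvectorBasis rfl with hb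
  set ev := hres.eigenvalues rfl with hev
  set w : Fin (Module.finrank ℂ U) → H := fun i => (b i : H) with hw
  have hwo : Orthonormal ℂ w := by
    have := b.orthonormal.comp_linearIsometry U.subtypeₗᵢ
    exact this
  have hSw : ∀ i, S (w i) = (ev i : ℂ) • w i := by
    intro i
    have := congrArg Subtype.val (hres.apply_eigenvectorBasis rfl i)
    exact this
  have hFF : ∀ i j, inner ℂ (F (w i)) (F (w j)) = (ev j : ℂ) * inner ℂ (w i) (w j) := by
    intro i j
    rw [← ContinuousLinearMap.adjoint_inner_right, ← hSa, hSw, inner_smul_right]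
  have hnorm : ∀ i, ‖F (w i)‖ ^ 2 = ev i := by
    intro i
    have h1 := hFF i i
    rw [inner_self_eq_norm_sq_to_K, inner_self_eq_norm_sq_to_K, hwo.1 i] at h1
    have h2 : ((‖F (w i)‖ ^ 2 : ℝ) : ℂ) = (ev i : ℂ) := by simpa using h1
    exact_mod_cast h2
  have hFw : ∀ i, 0 < ‖F (w i)‖ := by
    intro i
    rw [norm_pos_iff]
    intro h0
    obtain ⟨y, hy⟩ := (b i).2
    have h1 : inner ℂ (w i) (w i) = 0 := by
      have h2 : w i = ContinuousLinearMap.adjoint F y := hy.symm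
      conv_lhs => rw [h2]
      rw [ContinuousLinearMap.adjoint_inner_left, ← h2, h0, inner_zero_right]
    rw [inner_self_eq_zero] at h1
    have := hwo.1 i
    rw [h1, norm_zero] at this
    exact zero_ne_one this
  refine ⟨⟨Module.finrank ℂ U, fun i => ‖F (w i)‖, w,
    fun i => ((‖F (w i)‖⁻¹ : ℝ) : ℂ) • F (w i), ?_, hFw, hwo, ?_, ?_⟩⟩
  · intro i j hij
    refine le_of_sq_le_sq ?_ (norm_nonneg _)
    rw [hnorm, hnorm]
    exact hres.eigenvalues_antitone rfl hij
  · constructor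
    · intro i
      rw [norm_smul, Complex.norm_real, norm_inv, norm_norm, inv_mul_cancel₀ (hFw i).ne']
    · intro i j hij
      rw [inner_smul_left, inner_smul_right, hFF, hwo.2 hij]
      simp
  · intro x
    set z := x - ∑ i, inner ℂ (w i) x • w i with hz
    have hwz : ∀ i, inner ℂ (w i) z = 0 := by
      intro i
      rw [hz, inner_sub_right, hwo.inner_right_fintype, sub_self]
    -- `F* F z` lies in `U` and `z` is orthogonal to `U`, so `‖F z‖² = ⟨F* F z, z⟩ = 0`.
    have hFz : F z = 0 := by
      have h1 : inner ℂ (S z) z = 0 := by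
        have h2 := b.sum_repr' (⟨S z, ⟨F z, rfl⟩⟩ : U)
        have h3 := congrArg Subtype.val h2
        simp only [Submodule.coe_sum, Submodule.coe_smul] at h3
        rw [← h3, sum_inner]
        refine Finset.sum_eq_zero fun i _ => ?_
        rw [inner_smul_left]
        exact mul_eq_zero_of_right _ (hwz i)
      rwa [hSa, ContinuousLinearMap.adjoint_inner_left, inner_self_eq_zero] at h1
    have h1 : F x = ∑ i, inner ℂ (w i) x • F (w i) := by
      have : x = z + ∑ i, inner ℂ (w i) x • w i := by rw [hz]; abel
      conv_lhs => rw [this]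
      rw [map_add, hFz, zero_add, map_sum]
      simp
    rw [h1]
    refine Finset.sum_congr rfl fun i _ => ?_
    rw [smul_smul]
    congr 1
    have h4 : (‖F (w i)‖ : ℂ) ≠ 0 := by exact_mod_cast (hFw i).ne'
    push_cast
    field_simp

end FiniteRank

/-! ### Substochastic matrices and Hölder's inequality. -/

section Inequalities

/-- Doubly substochastic matrices are contractions in `ℓ^s`, `s ≥ 1`. -/
theorem sum_rpow_sum_mul_le {ι κ : Type*} [Fintype ι] [Fintype κ] {d : ι → κ → ℝ} {a : κ → ℝ}
    {C s : ℝ} (hs : 1 ≤ s) (hC : 0 ≤ C) (hd : ∀ k l, 0 ≤ d k l) (ha : ∀ l, 0 ≤ a l)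
    (hrow : ∀ k, ∑ l, d k l ≤ C) (hcol : ∀ l, ∑ k, d k l ≤ C) :
    ∑ k, (∑ l, d k l * a l) ^ s ≤ C ^ s * ∑ l, a l ^ s := by
  have hs0 : 0 < s := by linarith
  have h1 : ∀ k, (∑ l, d k l * a l) ^ s ≤ C ^ (s - 1) * ∑ l, d k l * a l ^ s := by
    intro k
    -- Hölder with the weights `d k`: `(∑ d a)^s ≤ (∑ d)^(s-1) ∑ d a^s`. Row sums control the first
    -- factor; column sums enter after summation over `k`.
    have h2 := Real.inner_le_weight_mul_Lp_of_nonneg Finset.univ hs (d k) a (hd k) ha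
    have h3 : 0 ≤ ∑ l, d k l := Finset.sum_nonneg fun l _ => hd k l
    have h4 : 0 ≤ ∑ l, d k l * a l ^ s :=
      Finset.sum_nonneg fun l _ => mul_nonneg (hd k l) (Real.rpow_nonneg (ha l) s)
    have h5 := Real.rpow_le_rpow
      (Finset.sum_nonneg fun l _ => mul_nonneg (hd k l) (ha l)) h2 hs0.le
    rw [Real.mul_rpow (by positivity) (by positivity), ← Real.rpow_mul h3, ← Real.rpow_mul h4,
      inv_mul_cancel₀ hs0.ne', Real.rpow_one, sub_mul, inv_mul_cancel₀ hs0.ne', one_mul] at h5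
    refine h5.trans (mul_le_mul_of_nonneg_right ?_ h4)
    exact Real.rpow_le_rpow h3 (hrow k) (by linarith)
  calc _ ≤ ∑ k, C ^ (s - 1) * ∑ l, d k l * a l ^ s := Finset.sum_le_sum fun k _ => h1 k
    _ = C ^ (s - 1) * ∑ l, (∑ k, d k l) * a l ^ s := by
        rw [← Finset.mul_sum, Finset.sum_comm]
        simp_rw [Finset.sum_mul]
    _ ≤ C ^ (s - 1) * ∑ l, C * a l ^ s := by
        gcongr with l
        · exact Real.rpow_nonneg (ha l) s
        · exact hcol l
    _ = C ^ s * ∑ l, a l ^ s := by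
        rw [← Finset.mul_sum, ← mul_assoc]
        congr 1
        rcases hC.eq_or_lt with h | h
        · rw [← h, mul_zero, Real.zero_rpow hs0.ne']
        · rw [Real.rpow_sub_one h.ne', div_mul_cancel₀ _ h.ne']

/-- The `ℓ^p` norm of a finite family of nonnegative reals is at most `A`. -/
def LpBound {ι : Type*} [Fintype ι] (p : ℝ≥0∞) (x : ι → ℝ) (A : ℝ) : Prop :=
  if p = ∞ then ∀ k, x k ≤ A else ∑ k, x k ^ p.toReal ≤ A ^ p.toReal

/-- Hölder's inequality. Infinite exponents are separate cases because `toReal` sends `∞` to `0`. -/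
theorem LpBound.mul {ι : Type*} [Fintype ι] {p q r : ℝ≥0∞} {x y : ι → ℝ} {A B : ℝ}
    (hA : 0 ≤ A) (hB : 0 ≤ B) (hx0 : ∀ k, 0 ≤ x k) (hy0 : ∀ k, 0 ≤ y k)
    (hp : p ≠ 0) (hq : q ≠ 0) (hr : r⁻¹ = p⁻¹ + q⁻¹) (hx : LpBound p x A) (hy : LpBound q y B) :
    LpBound r (fun k => x k * y k) (A * B) := by
  by_cases hpt : p = ∞
  · by_cases hqt : q = ∞
    · have hrt : r = ∞ := by simpa [hpt, hqt] using hr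
      simp only [LpBound, hpt, hqt, hrt, if_true] at hx hy ⊢
      exact fun k => mul_le_mul (hx k) (hy k) (hy0 k) hA
    · have hrq : r = q := by simpa [hpt] using hr
      rw [hrq]
      simp only [LpBound, hpt, hqt, if_true, if_false] at hx hy ⊢
      calc _ ≤ ∑ k, A ^ q.toReal * y k ^ q.toReal := by
            refine Finset.sum_le_sum fun k _ => ?_
            rw [← Real.mul_rpow hA (hy0 k)]
            exact Real.rpow_le_rpow (mul_nonneg (hx0 k) (hy0 k))
              (mul_le_mul_of_nonneg_right (hx k) (hy0 k)) ENNReal.toReal_nonneg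
        _ ≤ (A * B) ^ q.toReal := by
            rw [← Finset.mul_sum, Real.mul_rpow hA hB]
            exact mul_le_mul_of_nonneg_left hy (by positivity)
  · by_cases hqt : q = ∞
    · have hrp : r = p := by simpa [hqt] using hr
      rw [hrp]
      simp only [LpBound, hpt, hqt, if_true, if_false] at hx hy ⊢
      calc _ ≤ ∑ k, x k ^ p.toReal * B ^ p.toReal := by
            refine Finset.sum_le_sum fun k _ => ?_
            rw [← Real.mul_rpow (hx0 k) hB]
            exact Real.rpow_le_rpow (mul_nonneg (hx0 k) (hy0 k))
              (mul_le_mul_of_nonneg_left (hy k) (hx0 k)) ENNReal.toReal_nonneg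
        _ ≤ (A * B) ^ p.toReal := by
            rw [← Finset.sum_mul, Real.mul_rpow hA hB]
            exact mul_le_mul_of_nonneg_right hx (by positivity)
    · have hp0 : 0 < p.toReal := ENNReal.toReal_pos hp hpt
      have hq0 : 0 < q.toReal := ENNReal.toReal_pos hq hqt
      have hrt : r ≠ ∞ := by
        rintro rfl
        rw [ENNReal.inv_top, eq_comm, add_eq_zero, ENNReal.inv_eq_zero] at hr
        exact hpt hr.1
      have hrr : r.toReal⁻¹ = p.toReal⁻¹ + q.toReal⁻¹ := by
        rw [← ENNReal.toReal_inv, hr, ENNReal.toReal_add (by simpa using hp) (by simpa using hq),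
          ENNReal.toReal_inv, ENNReal.toReal_inv]
      have hr0 : 0 < r.toReal := by
        rw [← inv_pos, hrr]
        positivity
      simp only [LpBound, hpt, hqt, hrt, if_false] at hx hy ⊢
      have hx1 : 0 ≤ ∑ k, x k ^ p.toReal :=
        Finset.sum_nonneg fun k _ => Real.rpow_nonneg (hx0 k) _
      have hy1 : 0 ≤ ∑ k, y k ^ q.toReal :=
        Finset.sum_nonneg fun k _ => Real.rpow_nonneg (hy0 k) _
      calc _ ≤ (∑ k, x k ^ p.toReal) ^ (r.toReal / p.toReal) *
            (∑ k, y k ^ q.toReal) ^ (r.toReal / q.toReal) :=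
            Real.Lr_rpow_le_Lp_mul_Lq_of_nonneg Finset.univ ⟨hrr.symm, hp0, hq0⟩
              (fun k _ => hx0 k) (fun k _ => hy0 k)
        _ ≤ (A ^ p.toReal) ^ (r.toReal / p.toReal) * (B ^ q.toReal) ^ (r.toReal / q.toReal) := by
            gcongr
        _ = (A * B) ^ r.toReal := by
            rw [← Real.rpow_mul hA, ← Real.rpow_mul hB, mul_div_cancel₀ _ hp0.ne',
              mul_div_cancel₀ _ hq0.ne', Real.mul_rpow hA hB]

end Inequalities

/-! ### Singular values and matrix coefficients in orthonormal systems. -/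

section Schatten

variable {H : Type v} [NormedAddCommGroup H] [InnerProductSpace ℂ H]

theorem singularValue_le_enorm (T : H →L[ℂ] H) (k : ℕ) : singularValue T k ≤ ‖T‖ₑ := by
  refine (iInf₂_le (0 : H →L[ℂ] H) ?_).trans (by rw [sub_zero])
  rw [ContinuousLinearMap.toLinearMap_zero, LinearMap.rank_zero]
  exact zero_le

theorem singularValue_ne_top (T : H →L[ℂ] H) (k : ℕ) : singularValue T k ≠ ∞ :=
  ne_top_of_le_ne_top enorm_ne_top (singularValue_le_enorm T k)

theorem singularValue_le_add (S T : H →L[ℂ] H) (k : ℕ) :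
    singularValue S k ≤ singularValue T k + ‖S - T‖ₑ := by
  have h : singularValue T k + ‖S - T‖ₑ =
      ⨅ (F : H →L[ℂ] H) (_ : (F : H →ₗ[ℂ] H).rank ≤ k), (‖T - F‖ₑ + ‖S - T‖ₑ) := by
    rw [singularValue, ENNReal.iInf₂_add]
  rw [h]
  refine le_iInf₂ fun F hF => (iInf₂_le F hF).trans ?_
  rw [add_comm]
  have : S - F = (S - T) + (T - F) := by abel
  rw [this]
  exact enorm_add_le (S - T) (T - F)

/-- If `∑ |⟨f_k, J e_k⟩|^r` is bounded over all finite orthonormal systems, then `J` can be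
approximated in norm by operators of finite rank. -/
theorem exists_isFiniteRank_norm_sub_le {J : H →L[ℂ] H} {r D : ℝ} (hr : 0 < r)
    (h : ∀ (N : ℕ) (e f : Fin N → H), Orthonormal ℂ e → Orthonormal ℂ f →
      ∑ k, ‖inner ℂ (f k) (J (e k))‖ ^ r ≤ D) {ε : ℝ} (hε : 0 < ε) :
    ∃ F : H →L[ℂ] H, IsFiniteRank F ∧ ‖J - F‖ ≤ ε := by
  by_contra hne
  push Not at hne
  -- If no finite rank operator is within `ε`, orthonormal systems with all coefficients at least
  -- `ε` exist in every length, and `N ε^r` eventually exceeds `D`.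
  have hsys : ∀ N : ℕ, ∃ e f : Fin N → H, Orthonormal ℂ e ∧ Orthonormal ℂ f ∧
      ∀ k, ε ≤ ‖inner ℂ (f k) (J (e k))‖ := by
    intro N
    induction N with
    | zero => exact ⟨fun i => i.elim0, fun i => i.elim0, ⟨fun i => i.elim0, fun i => i.elim0⟩,
        ⟨fun i => i.elim0, fun i => i.elim0⟩, fun i => i.elim0⟩
    | succ N ih =>
      obtain ⟨e, f, he, hf, hef⟩ := ih
      set Se := Submodule.span ℂ (Set.range e)
      set Sf := Submodule.span ℂ (Set.range f)
      have : FiniteDimensional ℂ Se := FiniteDimensional.span_of_finite ℂ (Set.finite_range e)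
      have : FiniteDimensional ℂ Sf := FiniteDimensional.span_of_finite ℂ (Set.finite_range f)
      set Q := Se.starProjection
      set P := Sf.starProjection
      -- Chosen so that subtracting it from `J` leaves `(1 - P) J (1 - Q)`. This compression still
      -- has norm above `ε`, which yields new vectors orthogonal to the old ones.
      have hF : IsFiniteRank (P * J + ((1 - P) * J) * Q) :=
        ((isFiniteRank_starProjection Sf).mul_right J).add
          ((isFiniteRank_starProjection Se).mul_left _)
      have h1 := hne _ hF
      have h2 : J - (P * J + ((1 - P) * J) * Q) = (1 - P) * J * (1 - Q) := by noncomm_ring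
      rw [h2] at h1
      obtain ⟨x, hx⟩ : ∃ x, ε * ‖x‖ < ‖((1 - P) * J * (1 - Q)) x‖ := by
        by_contra hcon
        push Not at hcon
        exact absurd (ContinuousLinearMap.opNorm_le_bound _ hε.le hcon) (not_le.2 h1)
      set a := x - Q x with ha
      set y := J a - P (J a) with hy
      have hxy : ((1 - P) * J * (1 - Q)) x = y := by
        simp [mul_apply_eq_comp, sub_apply, hy, ha]
      rw [hxy] at hx
      have hy0 : 0 < ‖y‖ := lt_of_le_of_lt (by positivity) hx
      have ha0 : 0 < ‖a‖ := by
        rw [norm_pos_iff]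
        intro h0
        rw [hy, h0] at hy0
        simp at hy0
      have haE : ∀ i, inner ℂ a (e i) = 0 := fun i =>
        Submodule.starProjection_inner_eq_zero x (e i) (Submodule.subset_span ⟨i, rfl⟩)
      have hyF : ∀ z ∈ Sf, inner ℂ y z = 0 := fun z hz =>
        Submodule.starProjection_inner_eq_zero (J a) z hz
      have hax : ‖a‖ ≤ ‖x‖ := by
        have h3 : inner ℂ a (Q x) = 0 :=
          Submodule.starProjection_inner_eq_zero x (Q x) (Submodule.starProjection_apply_mem _ _)
        have h4 := norm_add_sq_eq_norm_sq_add_norm_sq_of_inner_eq_zero (𝕜 := ℂ) a (Q x) h3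
        have h5 : a + Q x = x := by rw [ha]; abel
        rw [h5] at h4
        nlinarith [norm_nonneg x, norm_nonneg a, norm_nonneg (Q x)]
      -- After normalization the new coefficient is `‖y‖ / ‖a‖`, which is at least `ε` because `ε
      -- ‖x‖ < ‖y‖` and `‖a‖ ≤ ‖x‖`.
      have hyJ : inner ℂ y (J a) = ((‖y‖ ^ 2 : ℝ) : ℂ) := by
        have h3 : J a = y + P (J a) := by rw [hy]; abel
        rw [h3, inner_add_right, hyF _ (Submodule.starProjection_apply_mem _ _), add_zero,
          inner_self_eq_norm_sq_to_K]
        norm_cast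
      refine ⟨Matrix.vecCons (((‖a‖⁻¹ : ℝ) : ℂ) • a) e, Matrix.vecCons (((‖y‖⁻¹ : ℝ) : ℂ) • y) f,
        orthonormal_vecCons_iff.2 ⟨?_, ?_, he⟩, orthonormal_vecCons_iff.2 ⟨?_, ?_, hf⟩, ?_⟩
      · rw [norm_smul, Complex.norm_real, norm_inv, norm_norm, inv_mul_cancel₀ ha0.ne']
      · intro i
        rw [inner_smul_left, haE, mul_zero]
      · rw [norm_smul, Complex.norm_real, norm_inv, norm_norm, inv_mul_cancel₀ hy0.ne']
      · intro i
        rw [inner_smul_left, hyF _ (Submodule.subset_span ⟨i, rfl⟩), mul_zero]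
      · intro k
        refine Fin.cases ?_ (fun i => ?_) k
        · simp only [Matrix.cons_val_zero]
          rw [map_smul, inner_smul_left, inner_smul_right, hyJ, norm_mul, norm_mul]
          simp only [Complex.conj_ofReal, Complex.norm_real, norm_inv, norm_norm, norm_pow]
          have h3 : ‖y‖⁻¹ * (‖a‖⁻¹ * ‖y‖ ^ 2) = ‖y‖ / ‖a‖ := by field_simp
          rw [h3, le_div_iff₀ ha0]
          exact (mul_le_mul_of_nonneg_left hax hε.le).trans hx.le
        · simpa using hef i
  obtain ⟨N, hN⟩ := exists_nat_gt (D / ε ^ r)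
  obtain ⟨e, f, he, hf, hef⟩ := hsys N
  have h1 := h N e f he hf
  have h2 : (N : ℝ) * ε ^ r ≤ ∑ k, ‖inner ℂ (f k) (J (e k))‖ ^ r := by
    calc (N : ℝ) * ε ^ r = ∑ _k : Fin N, ε ^ r := by simp
      _ ≤ _ := Finset.sum_le_sum fun k _ => Real.rpow_le_rpow hε.le (hef k) hr.le
  rw [div_lt_iff₀ (Real.rpow_pos_of_pos hε r)] at hN
  linarith

variable [CompleteSpace H]

/-- A bound for `∑ |⟨f_k, J e_k⟩|^r` over all finite orthonormal systems is a bound for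
`∑ s_k(J)^r`. -/
theorem tsum_singularValue_rpow_le {J : H →L[ℂ] H} {r D : ℝ} (hr : 0 < r)
    (h : ∀ (N : ℕ) (e f : Fin N → H), Orthonormal ℂ e → Orthonormal ℂ f →
      ∑ k, ‖inner ℂ (f k) (J (e k))‖ ^ r ≤ D) :
    ∑' k, singularValue J k ^ r ≤ ENNReal.ofReal D := by
  refine ENNReal.tsum_le_of_sum_range_le fun M => ?_
  set s : ℕ → ℝ := fun k => (singularValue J k).toReal with hs
  have hs0 : ∀ k, 0 ≤ s k := fun k => ENNReal.toReal_nonneg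
  have hsk : ∀ k, singularValue J k ^ r = ENNReal.ofReal (s k ^ r) := fun k => by
    rw [← ENNReal.ofReal_rpow_of_nonneg (hs0 k) hr.le,
      ENNReal.ofReal_toReal (singularValue_ne_top J k)]
  simp_rw [hsk]
  rw [← ENNReal.ofReal_sum_of_nonneg fun k _ => Real.rpow_nonneg (hs0 k) r]
  refine ENNReal.ofReal_le_ofReal ?_
  -- The test systems are the singular vectors of a finite rank `F` within `ε` of `J`. One `ε` is
  -- lost between `s_k(J)` and the singular value of `F`, another between the coefficients of `F`
  -- and of `J`.
  have key : ∀ ε : ℝ, 0 < ε → ∑ k ∈ Finset.range M, (max (s k - 2 * ε) 0) ^ r ≤ D := by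
    intro ε hε
    obtain ⟨F, hF, hJF⟩ := exists_isFiniteRank_norm_sub_le hr h hε
    obtain ⟨S⟩ := hF.nonempty_finiteSVD
    set t : ℕ → ℝ := fun k => if hk : k < S.len then
      ‖inner ℂ (S.v ⟨k, hk⟩) (J (S.u ⟨k, hk⟩))‖ else 0 with ht
    have ht0 : ∀ k, 0 ≤ t k := fun k => by
      simp only [ht]
      split_ifs
      · exact norm_nonneg _
      · exact le_rfl
    have hstep : ∀ (k : ℕ) (c : ℝ), 0 ≤ c → (∀ i : Fin S.len, k ≤ i → S.σ i ≤ c) →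
        s k ≤ c + ε := by
      intro k c hc hi
      have h1 := (singularValue_le_add J F k).trans
        (add_le_add (S.singularValue_le hc hi) le_rfl)
      have h2 := ENNReal.toReal_mono (by finiteness) h1
      rw [ENNReal.toReal_add (by finiteness) (by finiteness), ENNReal.toReal_ofReal hc,
        toReal_enorm] at h2
      exact h2.trans (by linarith)
    have hst : ∀ k, max (s k - 2 * ε) 0 ≤ t k := by
      intro k
      refine max_le ?_ (ht0 k)
      by_cases hk : k < S.len
      · have h1 := hstep k (S.σ ⟨k, hk⟩) (S.pos _).le fun i hi => S.antitone (Fin.le_def.2 hi)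
        have h2 : inner ℂ (S.v ⟨k, hk⟩) (F (S.u ⟨k, hk⟩)) = (S.σ ⟨k, hk⟩ : ℂ) := by
          rw [S.apply_u, inner_smul_right, inner_self_eq_norm_sq_to_K, S.orthonormal_v.1]
          simp
        have h3 : ‖inner ℂ (S.v ⟨k, hk⟩) ((J - F) (S.u ⟨k, hk⟩))‖ ≤ ε := by
          refine (norm_inner_le_norm _ _).trans ?_
          rw [S.orthonormal_v.1, one_mul]
          refine ((J - F).le_of_opNorm_le hJF _).trans ?_
          rw [S.orthonormal_u.1, mul_one]
        have h4 : (S.σ ⟨k, hk⟩ : ℂ) = inner ℂ (S.v ⟨k, hk⟩) (J (S.u ⟨k, hk⟩)) -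
            inner ℂ (S.v ⟨k, hk⟩) ((J - F) (S.u ⟨k, hk⟩)) := by
          rw [← h2, sub_apply, inner_sub_right]
          ring
        have h5 : S.σ ⟨k, hk⟩ ≤ t k + ε := by
          have h6 := congrArg norm h4
          rw [Complex.norm_real, Real.norm_of_nonneg (S.pos _).le] at h6
          rw [h6]
          refine (norm_sub_le _ _).trans (add_le_add (le_of_eq ?_) h3)
          simp only [ht, dif_pos hk]
        linarith
      · have h1 := hstep k 0 le_rfl fun i hi => absurd (hi.trans_lt i.2) hk
        simp only [ht, dif_neg hk]
        linarith
    calc ∑ k ∈ Finset.range M, (max (s k - 2 * ε) 0) ^ r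
        ≤ ∑ k ∈ Finset.range M, t k ^ r := Finset.sum_le_sum fun k _ =>
          Real.rpow_le_rpow (le_max_right _ _) (hst k) hr.le
      _ ≤ ∑ k ∈ Finset.range (S.len + M), t k ^ r :=
          Finset.sum_le_sum_of_subset_of_nonneg (Finset.range_mono (by omega))
            fun k _ _ => Real.rpow_nonneg (ht0 k) r
      _ = ∑ k ∈ Finset.range S.len, t k ^ r := by
          refine (Finset.sum_subset (Finset.range_mono (by omega)) fun k _ hk => ?_).symm
          simp only [ht, dif_neg (show ¬ k < S.len by simpa using hk), Real.zero_rpow hr.ne']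
      _ = ∑ k : Fin S.len, ‖inner ℂ (S.v k) (J (S.u k))‖ ^ r := by
          rw [Finset.sum_range]
          exact Finset.sum_congr rfl fun k _ => by simp only [ht, k.2, dif_pos]
      _ ≤ D := h _ _ _ S.orthonormal_u S.orthonormal_v
  have hlim : Tendsto (fun ε : ℝ => ∑ k ∈ Finset.range M, (max (s k - 2 * ε) 0) ^ r) (𝓝[>] 0)
      (𝓝 (∑ k ∈ Finset.range M, (max (s k - 2 * 0) 0) ^ r)) := by
    have hcont : Continuous fun ε : ℝ => ∑ k ∈ Finset.range M, (max (s k - 2 * ε) 0) ^ r := by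
      refine continuous_finsetSum _ fun k _ => ?_
      refine Continuous.rpow_const (by fun_prop) fun _ => Or.inr hr.le
    exact (hcont.tendsto 0).mono_left nhdsWithin_le_nhds
  simp only [mul_zero, sub_zero, max_eq_left (hs0 _)] at hlim
  exact le_of_tendsto hlim (eventually_mem_nhdsWithin.mono fun ε hε => key ε hε)

end Schatten

theorem LpBound.mono {ι : Type*} [Fintype ι] {p : ℝ≥0∞} {x y : ι → ℝ} {A : ℝ}
    (hx : ∀ k, 0 ≤ x k) (hxy : ∀ k, x k ≤ y k) (hy : LpBound p y A) : LpBound p x A := by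
  rw [LpBound] at hy ⊢
  split_ifs at hy ⊢
  · exact fun k => (hxy k).trans (hy k)
  · exact (Finset.sum_le_sum fun k _ =>
      Real.rpow_le_rpow (hx k) (hxy k) ENNReal.toReal_nonneg).trans hy

/-! ### Schatten estimates for columns and for the whole chain. -/

section Columns

variable {H : Type v} [NormedAddCommGroup H] [InnerProductSpace ℂ H] [CompleteSpace H]

/-- The squares `‖(F ⊗ 1) W e_k‖²` arise from the `σ_l²` through the nonnegative matrix `d`.
Bessel's inequality for `u` with `hG` bounds its row sums, and Bessel for `e` with `hG'` its column
sums. `sum_rpow_sum_mul_le` then applies with exponent `q / 2 ≥ 1`. -/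
theorem FiniteSVD.sum_norm_amp_rpow_le {F : H →L[ℂ] H} (S : FiniteSVD F) {G : ℕ → H →L[ℂ] H}
    {c q : ℝ} (hc : 0 ≤ c) (hq : 2 ≤ q) (hG : BoundedColumn c G)
    (hG' : BoundedColumn c fun j => ContinuousLinearMap.adjoint (G j))
    {W : H →L[ℂ] SeqSpace H} (hW : ∀ x j, W x j = G j x) {N : ℕ} {e : Fin N → H}
    (he : Orthonormal ℂ e) :
    ∑ k, ‖amp F (W (e k))‖ ^ q ≤ c ^ q * ∑ l, S.σ l ^ q := by
  set d : Fin N → Fin S.len → ℝ := fun k l => ∑' j, ‖inner ℂ (S.u l) (G j (e k))‖ ^ 2 with hd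
  have hsum : ∀ k l, Summable fun j => ‖inner ℂ (S.u l) (G j (e k))‖ ^ 2 := by
    intro k l
    refine Summable.of_nonneg_of_le (fun _ => by positivity) (fun j => ?_)
      (SeqSpace.hasSum_norm_sq (W (e k))).summable
    rw [hW]
    refine pow_le_pow_left₀ (norm_nonneg _) ((norm_inner_le_norm _ _).trans ?_) 2
    rw [S.orthonormal_u.1, one_mul]
  have hnorm : ∀ k, ‖amp F (W (e k))‖ ^ 2 = ∑ l, d k l * S.σ l ^ 2 := by
    intro k
    rw [← (SeqSpace.hasSum_norm_sq _).tsum_eq]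
    simp only [amp_apply, hW, S.norm_sq_apply]
    rw [Summable.tsum_finsetSum fun l _ => (hsum k l).mul_left _]
    refine Finset.sum_congr rfl fun l _ => ?_
    rw [tsum_mul_left, mul_comm]
  have hrow : ∀ k, ∑ l, d k l ≤ c ^ 2 := by
    intro k
    rw [← Summable.tsum_finsetSum fun l _ => hsum k l]
    refine Real.tsum_le_of_sum_le (fun _ => by positivity) fun s => ?_
    calc _ ≤ ∑ j ∈ s, ‖G j (e k)‖ ^ 2 := Finset.sum_le_sum fun j _ =>
          S.orthonormal_u.sum_inner_products_le _
      _ ≤ c ^ 2 := by simpa [he.1 k] using hG s (e k)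
  have hcol : ∀ l, ∑ k, d k l ≤ c ^ 2 := by
    intro l
    rw [← Summable.tsum_finsetSum fun k _ => hsum k l]
    refine Real.tsum_le_of_sum_le (fun _ => by positivity) fun s => ?_
    calc _ ≤ ∑ j ∈ s, ‖ContinuousLinearMap.adjoint (G j) (S.u l)‖ ^ 2 := by
          refine Finset.sum_le_sum fun j _ => ?_
          refine le_trans (le_of_eq ?_) (he.sum_inner_products_le _ (s := Finset.univ))
          refine Finset.sum_congr rfl fun k _ => ?_
          rw [ContinuousLinearMap.adjoint_inner_right, norm_inner_symm]
      _ ≤ c ^ 2 := by simpa [S.orthonormal_u.1 l] using hG' s (S.u l)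
  have hpow : ∀ z : ℝ, 0 ≤ z → (z ^ 2) ^ (q / 2) = z ^ q := fun z hz => by
    rw [← Real.rpow_natCast, ← Real.rpow_mul hz]
    congr 1
    push_cast
    ring
  have h := sum_rpow_sum_mul_le (d := d) (a := fun l => S.σ l ^ 2) (C := c ^ 2) (s := q / 2)
    (by linarith) (by positivity) (fun k l => tsum_nonneg fun _ => by positivity)
    (fun l => by positivity) hrow hcol
  simp_rw [← hnorm, hpow _ (norm_nonneg _), hpow _ hc, hpow _ (S.pos _).le] at h
  exact h

/-- Summability forces `s_k(T) → 0`, so some finite rank `F` is near `T`, but its singular values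
may exceed those of `T`. The approximant is therefore `T Q`, with `Q` the projection onto the range
of `F*`: `T - T Q = (T - F)(1 - Q)` stays small, and multiplying by `Q` cannot raise singular
values. -/
theorem exists_isFiniteRank_of_tsum_ne_top {T : H →L[ℂ] H} {q : ℝ} (hq : 0 < q)
    (hT : ∑' k, singularValue T k ^ q ≠ ∞) {ε : ℝ} (hε : 0 < ε) :
    ∃ F : H →L[ℂ] H, IsFiniteRank F ∧ ‖T - F‖ ≤ ε ∧
      ∀ k, singularValue F k ≤ singularValue T k := by
  obtain ⟨F, hF, hTF⟩ : ∃ F : H →L[ℂ] H, IsFiniteRank F ∧ ‖T - F‖ ≤ ε := by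
    have h1 := ENNReal.tendsto_atTop_zero_of_tsum_ne_top hT
    obtain ⟨k, hk⟩ := (h1.eventually_lt_const (u := ENNReal.ofReal ε ^ q)
      (ENNReal.rpow_pos (by simpa using hε) ENNReal.ofReal_ne_top)).exists
    rw [ENNReal.rpow_lt_rpow_iff hq, singularValue] at hk
    simp only [iInf_lt_iff] at hk
    obtain ⟨F, hF, hlt⟩ := hk
    refine ⟨F, hF.trans_lt Cardinal.natCast_lt_aleph0, ?_⟩
    rw [← ofReal_norm] at hlt
    exact ((ENNReal.ofReal_lt_ofReal_iff hε).1 hlt).le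
  have := hF.adjoint.finiteDimensional
  set U := LinearMap.range (ContinuousLinearMap.adjoint F : H →ₗ[ℂ] H)
  set Q := U.starProjection with hQ
  have hQn : ‖Q‖ ≤ 1 := U.starProjection_norm_le
  have hQn' : ‖1 - Q‖ ≤ 1 := by
    refine ContinuousLinearMap.opNorm_le_bound _ zero_le_one fun x => ?_
    have h3 : inner ℂ (x - Q x) (Q x) = 0 :=
      Submodule.starProjection_inner_eq_zero x (Q x) (Submodule.starProjection_apply_mem _ _)
    have h4 := norm_add_sq_eq_norm_sq_add_norm_sq_of_inner_eq_zero (𝕜 := ℂ) (x - Q x) (Q x) h3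
    rw [sub_add_cancel] at h4
    rw [sub_apply, one_apply_eq_self, one_mul]
    nlinarith [norm_nonneg x, norm_nonneg (x - Q x), norm_nonneg (Q x)]
  have hFQ : F * (1 - Q) = 0 := by
    ext x
    have h3 : inner ℂ (x - Q x) (ContinuousLinearMap.adjoint F (F (x - Q x))) = 0 :=
      Submodule.starProjection_inner_eq_zero x _ ⟨_, rfl⟩
    rw [ContinuousLinearMap.adjoint_inner_right, inner_self_eq_zero] at h3
    exact h3
  refine ⟨T * Q, (isFiniteRank_starProjection U).mul_left T, ?_, fun k => ?_⟩
  · have h1 : T - T * Q = (T - F) * (1 - Q) := by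
      rw [sub_mul, hFQ]
      noncomm_ring
    rw [h1]
    refine (norm_mul_le _ _).trans ?_
    calc _ ≤ ε * 1 := mul_le_mul hTF hQn' (norm_nonneg _) hε.le
      _ = ε := mul_one ε
  · refine le_iInf₂ fun R hR => ?_
    refine (iInf₂_le (R * Q) ((LinearMap.rank_comp_le_left (Q : H →ₗ[ℂ] H)
      (R : H →ₗ[ℂ] H)).trans hR)).trans ?_
    rw [← sub_mul, ← ofReal_norm, ← ofReal_norm]
    refine ENNReal.ofReal_le_ofReal ((norm_mul_le _ _).trans ?_)
    exact mul_le_of_le_one_right (norm_nonneg _) hQn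

theorem sum_norm_amp_rpow_le {T : H →L[ℂ] H} {G : ℕ → H →L[ℂ] H}
    {c q : ℝ} (hc : 0 ≤ c) (hq : 2 ≤ q) (hT : ∑' k, singularValue T k ^ q ≠ ∞)
    (hG : BoundedColumn c G) (hG' : BoundedColumn c fun j => ContinuousLinearMap.adjoint (G j))
    {W : H →L[ℂ] SeqSpace H} (hW : ∀ x j, W x j = G j x) {N : ℕ} {e : Fin N → H}
    (he : Orthonormal ℂ e) :
    ∑ k, ‖amp T (W (e k))‖ ^ q ≤ c ^ q * (∑' k, singularValue T k ^ q).toReal := by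
  have hq0 : 0 < q := by linarith
  choose F hF hTF hsv using fun m : ℕ =>
    exists_isFiniteRank_of_tsum_ne_top hq0 hT (ε := 1 / ((m : ℝ) + 1)) (by positivity)
  have hle : ∀ m, ∑ k, ‖amp (F m) (W (e k))‖ ^ q ≤
      c ^ q * (∑' k, singularValue T k ^ q).toReal := by
    intro m
    obtain ⟨S⟩ := (hF m).nonempty_finiteSVD
    refine (S.sum_norm_amp_rpow_le hc hq hG hG' hW he).trans
      (mul_le_mul_of_nonneg_left ?_ (by positivity))
    rw [← ENNReal.ofReal_le_iff_le_toReal hT,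
      ENNReal.ofReal_sum_of_nonneg fun l _ => Real.rpow_nonneg (S.pos l).le q]
    calc _ ≤ ∑ l : Fin S.len, singularValue T l ^ q := by
          refine Finset.sum_le_sum fun l _ => ?_
          rw [← ENNReal.ofReal_rpow_of_nonneg (S.pos l).le hq0.le]
          exact ENNReal.rpow_le_rpow ((S.le_singularValue l).trans (hsv m l)) hq0.le
      _ = ∑ l ∈ Finset.range S.len, singularValue T l ^ q :=
          (Finset.sum_range fun l => singularValue T l ^ q).symm
      _ ≤ _ := ENNReal.sum_le_tsum _
  have hlim : ∀ x, Tendsto (fun m => amp (F m) x) atTop (𝓝 (amp T x)) := by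
    intro x
    rw [tendsto_iff_norm_sub_tendsto_zero]
    have h1 : Tendsto (fun m : ℕ => 1 / ((m : ℝ) + 1) * ‖x‖) atTop (𝓝 0) := by
      simpa using tendsto_one_div_add_atTop_nhds_zero_nat.mul_const ‖x‖
    refine squeeze_zero (fun _ => norm_nonneg _) (fun m => ?_) h1
    have h2 : amp (F m) x - amp T x = - amp (T - F m) x := by
      apply lp.ext
      funext j
      simp
    rw [h2, norm_neg]
    exact (amp (T - F m)).le_of_opNorm_le ((norm_amp_le _).trans (hTF m)) x
  have hlim' : Tendsto (fun m => ∑ k, ‖amp (F m) (W (e k))‖ ^ q) atTop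
      (𝓝 (∑ k, ‖amp T (W (e k))‖ ^ q)) :=
    tendsto_finsetSum _ fun k _ => (hlim _).norm.rpow_const (Or.inr hq0.le)
  exact le_of_tendsto hlim' (Eventually.of_forall hle)

theorem lpBound_norm_amp {T : H →L[ℂ] H} {G : ℕ → H →L[ℂ] H} {c : ℝ} {q : ℝ≥0∞} (hc : 0 ≤ c)
    (hq : 2 ≤ q) (hT : MemSchatten q T)
    (hG : BoundedColumn c G) (hG' : BoundedColumn c fun j => ContinuousLinearMap.adjoint (G j))
    {W : H →L[ℂ] SeqSpace H} (hW : ∀ x j, W x j = G j x) {N : ℕ} {e : Fin N → H}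
    (he : Orthonormal ℂ e) :
    LpBound q (fun k => ‖amp T (W (e k))‖) (c * (schattenENorm q T).toReal) := by
  by_cases hqt : q = ∞
  · simp only [LpBound, schattenENorm, if_pos hqt, toReal_enorm]
    intro k
    have h1 : ‖W (e k)‖ ≤ c := by
      refine SeqSpace.norm_le hc fun s => ?_
      simpa [hW, he.1 k] using hG s (e k)
    refine ((amp T).le_of_opNorm_le (norm_amp_le T) _).trans ?_
    rw [mul_comm]
    exact mul_le_mul_of_nonneg_right h1 (norm_nonneg _)
  · have hq2 : 2 ≤ q.toReal := by
      simpa using ENNReal.toReal_mono hqt hq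
    have hq0 : 0 < q.toReal := by linarith
    simp only [MemSchatten, schattenENorm, if_neg hqt] at hT
    rw [ENNReal.rpow_lt_top_iff_of_pos (by positivity)] at hT
    simp only [LpBound, schattenENorm, if_neg hqt]
    rw [Real.mul_rpow hc ENNReal.toReal_nonneg, ← ENNReal.toReal_rpow, ← Real.rpow_mul
      ENNReal.toReal_nonneg, one_div_mul_cancel hq0.ne', Real.rpow_one]
    exact sum_norm_amp_rpow_le hc hq2 hT.ne hG hG' hW he

/-- The Schatten norm is controlled by matrix coefficients in orthonormal systems. -/
theorem schattenENorm_le_of_lpBound {J : H →L[ℂ] H} {r : ℝ≥0∞} {C : ℝ} (hr : r ≠ 0) (hC : 0 ≤ C)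
    (h : ∀ (N : ℕ) (e f : Fin N → H), Orthonormal ℂ e → Orthonormal ℂ f →
      LpBound r (fun k => ‖inner ℂ (f k) (J (e k))‖) C) :
    schattenENorm r J ≤ ENNReal.ofReal C := by
  by_cases hrt : r = ∞
  · rw [schattenENorm, if_pos hrt, ← ofReal_norm]
    refine ENNReal.ofReal_le_ofReal (ContinuousLinearMap.opNorm_le_bound _ hC fun x => ?_)
    rcases eq_or_ne (J x) 0 with hJ | hJ
    · rw [hJ, norm_zero]
      positivity
    · have hx : x ≠ 0 := fun h0 => hJ (by rw [h0, map_zero])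
      have hx0 := norm_pos_iff.2 hx
      have hJ0 := norm_pos_iff.2 hJ
      -- For `r = ∞` systems of length one suffice: the normalized `x` and `J x`.
      have hone : ∀ y : H, y ≠ 0 → Orthonormal ℂ fun _ : Fin 1 => ((‖y‖⁻¹ : ℝ) : ℂ) • y := by
        intro y hy
        refine ⟨fun _ => ?_, fun i j hij => absurd (Subsingleton.elim i j) hij⟩
        rw [norm_smul, Complex.norm_real, norm_inv, norm_norm,
          inv_mul_cancel₀ (norm_pos_iff.2 hy).ne']
      have h1 := h 1 _ _ (hone x hx) (hone (J x) hJ)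
      simp only [LpBound, if_pos hrt] at h1
      have h2 := h1 0
      rw [map_smul, inner_smul_left, inner_smul_right, inner_self_eq_norm_sq_to_K, norm_mul,
        norm_mul] at h2
      simp only [Complex.conj_ofReal, Complex.norm_real, norm_inv, norm_norm, norm_pow,
        Complex.coe_algebraMap] at h2
      have h3 : ‖J x‖⁻¹ * (‖x‖⁻¹ * ‖J x‖ ^ 2) = ‖J x‖ / ‖x‖ := by field_simp
      rwa [h3, div_le_iff₀ hx0] at h2
  · have hr0 : 0 < r.toReal := ENNReal.toReal_pos hr hrt
    simp only [LpBound, if_neg hrt] at h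
    have h1 := tsum_singularValue_rpow_le hr0 h
    rw [schattenENorm, if_neg hrt]
    refine (ENNReal.rpow_le_rpow h1 (by positivity)).trans (le_of_eq ?_)
    rw [← ENNReal.ofReal_rpow_of_nonneg hC hr0.le, ← ENNReal.rpow_mul,
      mul_one_div_cancel hr0.ne', ENNReal.rpow_one]

theorem inner_amp_right (T : H →L[ℂ] H) (x y : SeqSpace H) :
    inner ℂ x (amp T y) = inner ℂ (amp (ContinuousLinearMap.adjoint T) x) y := by
  rw [lp.inner_eq_tsum, lp.inner_eq_tsum]
  simp only [amp_apply, ContinuousLinearMap.adjoint_inner_left]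

/-- The chain is `V* (T₀ ⊗ 1) X (T_last ⊗ 1) W`, where `X` contains all matrices and all inner
operators and only its norm matters. Moving `T₀` to the other side of the inner product leaves two
column estimates, one for `V` with `T₀*` and one for `W` with `T_last`. -/
theorem schattenENorm_chainOp_le {m : ℕ} {A G : ℕ → H →L[ℂ] H} {V W : H →L[ℂ] SeqSpace H}
    {Bop : Fin (m + 1) → SeqSpace H →L[ℂ] SeqSpace H} {T : Fin (m + 2) → H →L[ℂ] H}
    {a c : ℝ} {b : Fin (m + 1) → ℝ} {p q r : ℝ≥0∞} (ha : 0 ≤ a) (hc : 0 ≤ c)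
    (hA : BoundedColumn a A) (hA' : BoundedColumn a fun j => ContinuousLinearMap.adjoint (A j))
    (hG : BoundedColumn c G) (hG' : BoundedColumn c fun j => ContinuousLinearMap.adjoint (G j))
    (hV : ∀ x j, V x j = ContinuousLinearMap.adjoint (A j) x) (hW : ∀ x j, W x j = G j x)
    (hb : ∀ i, ‖Bop i‖ ≤ b i) (hp : 2 ≤ p) (hq : 2 ≤ q) (hr : r⁻¹ = p⁻¹ + q⁻¹)
    (hT₁ : MemSchatten p (T 0)) (hT₂ : MemSchatten q (T (Fin.last (m + 1)))) :
    schattenENorm r (chainOp V W Bop T) ≤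
      ENNReal.ofReal (((∏ i : Fin m, ‖T i.succ.castSucc‖) * ∏ i, b i) *
        ((a * (schattenENorm p (T 0)).toReal) *
          (c * (schattenENorm q (T (Fin.last (m + 1)))).toReal))) := by
  have hp0 : p ≠ 0 := (lt_of_lt_of_le two_pos hp).ne'
  have hq0 : q ≠ 0 := (lt_of_lt_of_le two_pos hq).ne'
  have hr0 : r ≠ 0 := by
    rintro rfl
    rw [ENNReal.inv_zero] at hr
    exact (ENNReal.add_ne_top.2 ⟨ENNReal.inv_ne_top.2 hp0, ENNReal.inv_ne_top.2 hq0⟩) hr.symm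
  have hb0 : ∀ i, 0 ≤ b i := fun i => (norm_nonneg _).trans (hb i)
  set X : SeqSpace H →L[ℂ] SeqSpace H :=
    (List.ofFn fun i : Fin m => Bop i.castSucc * amp (T i.castSucc.succ)).prod *
      Bop (Fin.last m) with hX
  set x₀ : ℝ := (∏ i : Fin m, ‖T i.succ.castSucc‖) * ∏ i, b i with hx₀
  have hx₀0 : 0 ≤ x₀ := mul_nonneg (Finset.prod_nonneg fun _ _ => norm_nonneg _)
    (Finset.prod_nonneg fun i _ => hb0 i)
  have hXn : ‖X‖ ≤ x₀ := by
    have h1 : ‖(List.ofFn fun i : Fin m => Bop i.castSucc * amp (T i.castSucc.succ)).prod‖ ≤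
        ∏ i : Fin m, (b i.castSucc * ‖T i.castSucc.succ‖) :=
      norm_ofFn_prod_le fun i => (norm_mul_le _ _).trans
        (mul_le_mul (hb _) (norm_amp_le _) (norm_nonneg _) (hb0 _))
    refine (norm_mul_le _ _).trans ((mul_le_mul h1 (hb _) (norm_nonneg _)
      (Finset.prod_nonneg fun i _ => mul_nonneg (hb0 _) (norm_nonneg _))).trans (le_of_eq ?_))
    rw [hx₀, Fin.prod_univ_castSucc, Finset.prod_mul_distrib]
    simp only [Fin.succ_castSucc]
    ring
  have hprod : (List.ofFn fun i => Bop i * amp (T i.succ)).prod =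
      X * amp (T (Fin.last (m + 1))) := by
    rw [List.ofFn_succ', List.concat_eq_append, List.prod_append, List.prod_singleton, hX,
      mul_assoc]
    rfl
  have hT₁' : MemSchatten p (ContinuousLinearMap.adjoint (T 0)) :=
    (schattenENorm_adjoint_le p (T 0)).trans_lt hT₁
  have hsch : (schattenENorm p (ContinuousLinearMap.adjoint (T 0))).toReal ≤
      (schattenENorm p (T 0)).toReal :=
    ENNReal.toReal_mono hT₁.ne (schattenENorm_adjoint_le p (T 0))
  have h0 : 0 ≤ a * (schattenENorm p (T 0)).toReal := mul_nonneg ha ENNReal.toReal_nonneg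
  have h0' : 0 ≤ c * (schattenENorm q (T (Fin.last (m + 1)))).toReal :=
    mul_nonneg hc ENNReal.toReal_nonneg
  refine schattenENorm_le_of_lpBound hr0 (by positivity) fun N e f he hf => ?_
  have hA'' : BoundedColumn a fun j =>
      ContinuousLinearMap.adjoint (ContinuousLinearMap.adjoint (A j)) := by
    simpa only [ContinuousLinearMap.adjoint_adjoint] using hA
  have hx := lpBound_norm_amp ha hp hT₁' hA' hA'' hV hf
  have hx' : LpBound p (fun k => ‖amp (ContinuousLinearMap.adjoint (T 0)) (V (f k))‖)
      (a * (schattenENorm p (T 0)).toReal) := by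
    have hle := mul_le_mul_of_nonneg_left hsch ha
    rw [LpBound] at hx ⊢
    split_ifs at hx ⊢
    · exact fun k => (hx k).trans hle
    · exact hx.trans (Real.rpow_le_rpow (mul_nonneg ha ENNReal.toReal_nonneg) hle
        ENNReal.toReal_nonneg)
  have hy := lpBound_norm_amp hc hq hT₂ hG hG' hW he
  have hxy := hx'.mul h0 h0' (fun _ => norm_nonneg _) (fun _ => norm_nonneg _) hp0 hq0 hr hy
  -- Viewing the factor `x₀` as an `ℓ^∞` family lets Hölder absorb it without a case split on `r`.
  have hconst : LpBound ∞ (fun _ : Fin N => x₀) x₀ := by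
    simp [LpBound]
  have hall := hconst.mul (r := r) hx₀0 (mul_nonneg h0 h0') (fun _ => hx₀0)
    (fun _ => mul_nonneg (norm_nonneg _) (norm_nonneg _)) ENNReal.top_ne_zero hr0
    (by rw [ENNReal.inv_top, zero_add]) hxy
  refine hall.mono (fun _ => norm_nonneg _) fun k => ?_
  rw [inner_chainOp, hprod, mul_apply_eq_comp, inner_amp_right]
  refine (norm_inner_le_norm _ _).trans ?_
  refine (mul_le_mul_of_nonneg_left (X.le_of_opNorm_le hXn _) (norm_nonneg _)).trans
    (le_of_eq ?_)
  ring

end Columns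

end OperatorIntegral

end

/-- The number of spectral measures is `m = n + 2 ≥ 3`, and `T 0, …, T (Fin.last n)` are the
`m - 1` operators standing between them. -/
theorem theorem3p1 {H : Type*} [NormedAddCommGroup H] [InnerProductSpace ℂ H] [CompleteSpace H]
    (n : ℕ) (hn : 1 ≤ n) {X : Fin (n + 2) → Type*} [∀ i, MeasurableSpace (X i)]
    (E : ∀ i, OperatorIntegral.SpectralMeasure (X i) H)
    (Ψ : (∀ i, X i) → ℂ) (hΨ : OperatorIntegral.MemHaagerup E Ψ)
    (T : Fin (n + 1) → H →L[ℂ] H) (p q r : ℝ≥0∞) (hp : 2 ≤ p) (hq : 2 ≤ q)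
    (hr : r⁻¹ = p⁻¹ + q⁻¹)
    (hT₁ : OperatorIntegral.MemSchatten p (T 0))
    (hT₂ : OperatorIntegral.MemSchatten q (T (Fin.last n))) :
    OperatorIntegral.IsMultipleOperatorIntegral E Ψ T
        (OperatorIntegral.multipleOperatorIntegral E Ψ T) ∧
      OperatorIntegral.MemSchatten r (OperatorIntegral.multipleOperatorIntegral E Ψ T) ∧
      OperatorIntegral.schattenENorm r (OperatorIntegral.multipleOperatorIntegral E Ψ T) ≤
        OperatorIntegral.haagerupENorm E Ψ * OperatorIntegral.schattenENorm p (T 0) *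
          (∏ j ∈ Finset.Ioo 0 (Fin.last n), ‖T j‖ₑ) *
          OperatorIntegral.schattenENorm q (T (Fin.last n)) := by
  open OperatorIntegral in
  have hex : ∃ J, IsMultipleOperatorIntegral E Ψ T J :=
    hΨ.some.exists_isMultipleOperatorIntegral T
  have hJ : IsMultipleOperatorIntegral E Ψ T (multipleOperatorIntegral E Ψ T) := by
    rw [multipleOperatorIntegral, dif_pos hex]
    exact hex.choose_spec
  set J := multipleOperatorIntegral E Ψ T
  -- With at least three measures, `T 0` and the last operator are different factors.
  obtain ⟨m, rfl⟩ : ∃ m, n = m + 1 := ⟨n - 1, by omega⟩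
  have hprod : ∏ j ∈ Finset.Ioo 0 (Fin.last (m + 1)), ‖T j‖ₑ =
      ∏ i : Fin m, ‖T i.succ.castSucc‖ₑ := by
    symm
    refine Finset.prod_bij (fun i _ => i.succ.castSucc) (fun i _ => ?_) (fun i _ j _ hij => ?_)
      (fun j hj => ?_) (fun _ _ => rfl)
    · rw [Finset.mem_Ioo, Fin.lt_def, Fin.lt_def]
      simp
    · simpa using hij
    · rw [Finset.mem_Ioo, Fin.lt_def, Fin.lt_def] at hj
      simp only [Fin.val_zero, Fin.val_last] at hj
      refine ⟨⟨j - 1, by omega⟩, Finset.mem_univ _, ?_⟩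
      ext
      simp
      omega
  have hc : schattenENorm p (T 0) * (∏ j ∈ Finset.Ioo 0 (Fin.last (m + 1)), ‖T j‖ₑ) *
      schattenENorm q (T (Fin.last (m + 1))) ≠ ∞ :=
    ENNReal.mul_ne_top (ENNReal.mul_ne_top hT₁.ne (ENNReal.prod_ne_top fun _ _ => enorm_ne_top))
      hT₂.ne
  have hbound : ∀ R : HaagerupRep E Ψ, schattenENorm r J ≤ R.size *
      (schattenENorm p (T 0) * (∏ j ∈ Finset.Ioo 0 (Fin.last (m + 1)), ‖T j‖ₑ) *
        schattenENorm q (T (Fin.last (m + 1)))) := by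
    intro R
    obtain ⟨V, W, Bop, hV, hW, hlim, hBn⟩ := R.exists_chain
    have hJR : J = chainOp V W Bop T := by
      ext h
      refine ext_inner_left ℂ fun g => ?_
      exact tendsto_nhds_unique (hJ.2 R g h) (hlim T g h)
    rw [hJR]
    refine (schattenENorm_chainOp_le ENNReal.toReal_nonneg ENNReal.toReal_nonneg
      (SpectralMeasure.boundedColumn_integral R.measurable_α R.bounded_α)
      (SpectralMeasure.boundedColumn_adjoint_integral R.measurable_α R.bounded_α)
      (SpectralMeasure.boundedColumn_integral R.measurable_γ R.bounded_γ)
      (SpectralMeasure.boundedColumn_adjoint_integral R.measurable_γ R.bounded_γ)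
      hV hW hBn hp hq hr hT₁ hT₂).trans (le_of_eq ?_)
    have hnn : ∀ x : ℝ≥0∞, 0 ≤ x.toReal := fun _ => ENNReal.toReal_nonneg
    rw [hprod, HaagerupRep.size,
      ENNReal.ofReal_mul (mul_nonneg (Finset.prod_nonneg fun _ _ => norm_nonneg _)
        (Finset.prod_nonneg fun _ _ => hnn _)),
      ENNReal.ofReal_mul (Finset.prod_nonneg fun _ _ => norm_nonneg _),
      ENNReal.ofReal_mul (mul_nonneg (hnn _) (hnn _)), ENNReal.ofReal_mul (hnn _),
      ENNReal.ofReal_mul (hnn _), ENNReal.ofReal_toReal hT₁.ne, ENNReal.ofReal_toReal hT₂.ne,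
      ENNReal.ofReal_toReal R.bounded_α.ne, ENNReal.ofReal_toReal R.bounded_γ.ne,
      ENNReal.ofReal_prod_of_nonneg fun _ _ => norm_nonneg _,
      ENNReal.ofReal_prod_of_nonneg fun _ _ => hnn _]
    simp only [ofReal_norm, ENNReal.ofReal_toReal (R.bounded_β _).ne]
    ring
  have hmain : schattenENorm r J ≤ haagerupENorm E Ψ *
      (schattenENorm p (T 0) * (∏ j ∈ Finset.Ioo 0 (Fin.last (m + 1)), ‖T j‖ₑ) *
        schattenENorm q (T (Fin.last (m + 1)))) := by
    have : Nonempty (HaagerupRep E Ψ) := hΨ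
    -- `J` is the same for all representations, so the infimum of the bounds may be taken; it
    -- commutes with multiplication by the remaining constant because that constant is finite.
    rw [haagerupENorm, ENNReal.iInf_mul fun h => absurd h hc]
    exact le_iInf hbound
  have hfin : haagerupENorm E Ψ ≠ ∞ := by
    obtain ⟨R⟩ := hΨ
    refine ne_top_of_le_ne_top ?_ (iInf_le _ R)
    exact ENNReal.mul_ne_top (ENNReal.mul_ne_top R.bounded_α.ne
      (ENNReal.prod_ne_top fun i _ => (R.bounded_β i).ne)) R.bounded_γ.ne
  refine ⟨hJ, hmain.trans_lt (ENNReal.mul_lt_top hfin.lt_top hc.lt_top), hmain.trans (le_of_eq ?_)⟩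
  ring
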